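/- **Language.** Fix countably infinite sets of individual variables $Var$, justification variables $p_i$ and justification constants $c_i$, and infinitely many predicate symbols of each arity. Justification terms: $t::=p_i\mid c_i\mid (t\cdot t)\mid (t+t)\mid {!t}\mid gen_x(t)$ ($x\in Var$). Formulas are built from atomic formulas $P(x_1,\dots,x_n)$ by $\neg,\wedge,\vee,\to,\leftrightarrow,\forall x,\exists x$, and by $\Box_X\Phi$ and $t{:}_X\Phi$ for finite $X\subseteq Var$. Free variables $FV$ are defined as usual, with $FV(\Box_X\Phi)=FV(t{:}_X\Phi)=X$; thus these operators bind the free variables of $\Phi$ outside $X$, and the occurrences in the index $X$ are free. A formula is closed if it has no free variables. A substitution of variables for free variables is admissible if no replaced occurrence becomes bound (by a quantifier, $\Box_X$ or $t{:}_X$) and no bound occurrence becomes free. **Logic.** The axioms are: classical first-order axioms (all instances of propositional tautologies; $\forall x\Phi\to\Phi[x/y]$ and $\Phi[x/y]\to\exists x\Phi$ for admissible $[x/y]$; $\forall x(\Phi\to\Psi)\to(\Phi\to\forall x\Psi)$ and $\forall x(\Psi\to\Phi)\to(\exists x\Psi\to\Phi)$ for $x\notin FV(\Phi)$); and, for all terms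 $t,s$, formulas $\Phi,\Psi$, finite sets $X$ and variables $x,y$: - $t{:}_{X\cup\{y\}}\Phi\to t{:}_X\Phi$ and $\Box_{X\cup\{y\}}\Phi\to\Box_X\Phi$, if $y\notin FV(\Phi)$; - $t{:}_X\Phi\to t{:}_{X\cup\{y\}}\Phi$ and $\Box_X\Phi\to\Box_{X\cup\{y\}}\Phi$; - $t{:}_X\Phi\to\Phi$ and $\Box_X\Phi\to\Phi$; - $t{:}_X(\Phi\to\Psi)\to(s{:}_X\Phi\to(t\cdot s){:}_X\Psi)$ and $\Box_X(\Phi\to\Psi)\to(\Box_X\Phi\to\Box_X\Psi)$; - $t{:}_X\Phi\to(t+s){:}_X\Phi$ and $s{:}_X\Phi\to(t+s){:}_X\Phi$; - $t{:}_X\Phi\to {!t}{:}_X\,t{:}_X\Phi$ and $\Box_X\Phi\to\Box_X\Box_X\Phi$; - $t{:}_X\Phi\to gen_x(t){:}_X\forall x\Phi$ and $\Box_X\Phi\to\Box_X\forall x\Phi$, if $x\notin X$; - $t{:}_X\Phi\to\Box_X\Phi$. A constant specification $CS$ is any set of formulas $c{:}_\varnothing A$ with $c$ a justification constant and $A$ an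 axiom. $\Gamma\vdash_{CS}\Phi$ means that $\Phi$ is obtained from $\Gamma$, the axioms and $CS$ by modus ponens, generalization $\Phi/\forall x\Phi$ for $x$ not free in $\Gamma$, and necessitation $A/\Box_\varnothing A$ for axioms $A$. **Models.** A Fitting model is a tuple $(W,R,(D_w)_{w\in W},I,\mathcal E)$ with $W\neq\varnothing$; $R$ a reflexive and transitive relation on $W$; sets $D_w\ne\varnothing$ with $D_w\subseteq D_u$ whenever $wRu$; $I(P,w)\subseteq D_w^n$ for each $n$-ary $P$; and, with $D=\bigcup_w D_w$, a set $\mathcal E(t,\Phi,f)\subseteq W$ for every term $t$, formula $\Phi$ and finite valuation $f$ (a function from a finite $Dom(f)\subseteq Var$ to $D$). Here $f\upharpoonright Y$ is the restriction of $f$ to $Y\cap Dom(f)$. It is required that: - (adequacy) $w\in\mathcal E(t,\Phi,f)$ implies $Im(f)\subseteq D_w$; - (substitution) if $\sigma$ is an admissible substitution for $\Phi$ and $\sigma(x)\in Dom(f)$ for every $x\in FV(\Phi)$ with $\sigma(x)\neq x$, then $\mathcal E(t,\Phi\sigma,f\upharpoonright FV(\Phi\sigma))=\mathcal E(t,\Phi,f\circ\sigma)$,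 where $f\circ\sigma$ has domain $\{x\in FV(\Phi):\sigma(x)\in Dom(f)\}$ and sends $x$ to $f(\sigma(x))$; - ($R$-closure) $wRu$ and $w\in\mathcal E(t,\Phi,f)$ imply $u\in\mathcal E(t,\Phi,f)$; - (extension) if $g$ is a finite extension of $f$ with $Im(g)\subseteq D_w$, then $w\in\mathcal E(t,\Phi,f)$ implies $w\in\mathcal E(t,\Phi,g)$; - (restriction) $\mathcal E(t,\Phi,f)\subseteq\mathcal E(t,\Phi,f\upharpoonright FV(\Phi))$; - $\mathcal E(t,\Phi\to\Psi,f)\cap\mathcal E(s,\Phi,f)\subseteq\mathcal E(t\cdot s,\Psi,f)$; - $\mathcal E(t,\Phi,f)\cup\mathcal E(s,\Phi,f)\subseteq\mathcal E(t+s,\Phi,f)$; - if $w\in\mathcal E(t,\Phi,f)$, $g$ is a finite extension of $f$ with $Im(g)\subseteq D_w$, and $Dom(f)\cap FV(\Phi)\subseteq X\subseteq Dom(g)$, then $w\in\mathcal E(!t,t{:}_X\Phi,g)$; - $\mathcal E(t,\Phi,f)\subseteq\mathcal E(gen_x(t),\forall x\Phi,f)$ if $x\notin Dom(f)\cap FV(\Phi)$.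 The model meets $CS$ if $\mathcal E(c,\Phi,\varnothing)=W$ whenever $c{:}_\varnothing\Phi\in CS$. **Truth.** For a valuation $\nu:Var\to D$, truth of a formula at $w$ under $\nu$ is defined by: - $P(x_1,\dots,x_n)$ is true iff $(\nu(x_1),\dots,\nu(x_n))\in I(P,w)$; - $\neg\Psi$ is true iff $\nu(FV(\Psi))\subseteq D_w$ and $\Psi$ is not true at $w$ under $\nu$; - $\Psi\wedge\Theta$ is true iff both $\Psi$ and $\Theta$ are; - $\forall x\Psi$ is true iff $\Psi$ is true at $w$ under $\nu^x_a$ for every $a\in D_w$; - $\vee,\to,\leftrightarrow,\exists$ are evaluated as the usual abbreviations through $\neg,\wedge,\forall$ (equivalently: classically, together with the requirement that $\nu$ maps the free variables of the formula into $D_w$); - $\Box_X\Psi$ is true iff $\nu(X)\subseteq D_w$ and, for all $u$ with $wRu$ and all $d_1,\dots,d_n\in D_u$, $\Psi$ is true at $u$ under $\nu^{y_1,\dots,y_n}_{d_1,\dots,d_n}$, where $\{y_1,\dots,y_n\}=FV(\Psi)\setminus X$; - $t{:}_X\Psi$ is true iff $\Box_X\Psi$ is true and $w\in\mathcal E(t,\Psi,\nu\upharpoonright(FV(\Psi)\cap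 X))$. **Theorem (Strong Completeness).** For every constant specification $CS$, every set $\Gamma$ of closed formulas and every closed formula $\Phi$: if $\Gamma\nvdash_{CS}\Phi$, then there exist a Fitting model meeting $CS$, a valuation $\nu$ and a world $w$ such that all formulas of $\Gamma$ are true at $w$ under $\nu$ and $\Phi$ is not true at $w$ under $\nu$. -/

import Mathlib

namespace FOLPBox

/-- Individual variables. -/
abbrev Var : Type := ℕ

/-- Justification terms, built from justification variables and constants
by application, sum, proof checker and the operations `gen_x`. -/
inductive JTerm : Type
  | jvar (i : ℕ) : JTerm
  | const (i : ℕ) : JTerm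
  | app (t s : JTerm) : JTerm
  | sum (t s : JTerm) : JTerm
  | bang (t : JTerm) : JTerm
  | gen (x : Var) (t : JTerm) : JTerm

/-- Formulas. `atom n i xs` is the `i`-th predicate symbol of arity `n` applied to the variables
`xs`; `box X Φ` is the binding modality with index set `X`; `just t X Φ` is `t :_X Φ`. -/
inductive Formula : Type
  | atom (n i : ℕ) (xs : Fin n → Var) : Formula
  | neg (Φ : Formula) : Formula
  | conj (Φ Ψ : Formula) : Formula
  | disj (Φ Ψ : Formula) : Formula
  | imp (Φ Ψ : Formula) : Formula
  | iff (Φ Ψ : Formula) : Formula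
  | all (x : Var) (Φ : Formula) : Formula
  | ex (x : Var) (Φ : Formula) : Formula
  | box (X : Finset Var) (Φ : Formula) : Formula
  | just (t : JTerm) (X : Finset Var) (Φ : Formula) : Formula

namespace Formula

/-- The set of free variables of a formula. -/
def FV : Formula → Finset Var
  | atom _ _ xs => Finset.univ.image xs
  | neg Φ => Φ.FV
  | conj Φ Ψ => Φ.FV ∪ Ψ.FV
  | disj Φ Ψ => Φ.FV ∪ Ψ.FV
  | imp Φ Ψ => Φ.FV ∪ Ψ.FV
  | iff Φ Ψ => Φ.FV ∪ Ψ.FV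
  | all x Φ => Φ.FV.erase x
  | ex x Φ => Φ.FV.erase x
  | box X _ => X
  | just _ X _ => X

/-- A formula is closed if it has no free variables. -/
def Closed (Φ : Formula) : Prop := Φ.FV = ∅

/-- `restrictSubst X σ` acts as `σ` on `X` and as the identity outside `X`. -/
def restrictSubst (X : Finset Var) (σ : Var → Var) : Var → Var :=
  fun z => if z ∈ X then σ z else z

/-- Simultaneous replacement of every free occurrence of each variable `z` by `σ z`.
The occurrences in the index `X` of a modality or of a justification operator are free, and this
operator binds all variables outside `X`. -/
def subst : (Var → Var) → Formula → Formula
  | σ, atom n i xs => atom n i (fun k => σ (xs k))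
  | σ, neg Φ => neg (subst σ Φ)
  | σ, conj Φ Ψ => conj (subst σ Φ) (subst σ Ψ)
  | σ, disj Φ Ψ => disj (subst σ Φ) (subst σ Ψ)
  | σ, imp Φ Ψ => imp (subst σ Φ) (subst σ Ψ)
  | σ, iff Φ Ψ => iff (subst σ Φ) (subst σ Ψ)
  | σ, all x Φ => all x (subst (Function.update σ x x) Φ)
  | σ, ex x Φ => ex x (subst (Function.update σ x x) Φ)
  | σ, box X Φ => box (X.image σ) (subst (restrictSubst X σ) Φ)
  | σ, just t X Φ => just t (X.image σ) (subst (restrictSubst X σ) Φ)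

/-- The substitution `σ` causes no collision of variables in the formula: no free occurrence is
replaced by a variable that is bound at that place, either by a quantifier or by one of the
operators `□_X`, `t :_X` (which bind the free variables of their argument lying outside `X`). -/
def Admissible : (Var → Var) → Formula → Prop
  | _, atom _ _ _ => True
  | σ, neg Φ => Admissible σ Φ
  | σ, conj Φ Ψ => Admissible σ Φ ∧ Admissible σ Ψ
  | σ, disj Φ Ψ => Admissible σ Φ ∧ Admissible σ Ψ
  | σ, imp Φ Ψ => Admissible σ Φ ∧ Admissible σ Ψ
  | σ, iff Φ Ψ => Admissible σ Φ ∧ Admissible σ Ψ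
  | σ, all x Φ => (∀ z ∈ Φ.FV, z ≠ x → σ z ≠ x) ∧ Admissible (Function.update σ x x) Φ
  | σ, ex x Φ => (∀ z ∈ Φ.FV, z ≠ x → σ z ≠ x) ∧ Admissible (Function.update σ x x) Φ
  | σ, box X Φ => (∀ z ∈ X, σ z ∉ Φ.FV \ X) ∧ Admissible (restrictSubst X σ) Φ
  | σ, just _ X Φ => (∀ z ∈ X, σ z ∉ Φ.FV \ X) ∧ Admissible (restrictSubst X σ) Φ

/-- The substitution `[x/y]` replacing `x` by `y`. -/
def single (x y : Var) : Var → Var := Function.update id x y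

/-- A Boolean valuation: an assignment of truth values to all formulas that respects the
propositional connectives (and is arbitrary on the other formulas). -/
structure IsBooleanValuation (v : Formula → Prop) : Prop where
  neg : ∀ Φ, v (neg Φ) ↔ ¬ v Φ
  conj : ∀ Φ Ψ, v (conj Φ Ψ) ↔ (v Φ ∧ v Ψ)
  disj : ∀ Φ Ψ, v (disj Φ Ψ) ↔ (v Φ ∨ v Ψ)
  imp : ∀ Φ Ψ, v (imp Φ Ψ) ↔ (v Φ → v Ψ)
  iff : ∀ Φ Ψ, v (iff Φ Ψ) ↔ (v Φ ↔ v Ψ)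

/-- Instances of classical propositional tautologies. -/
def IsTautology (Φ : Formula) : Prop :=
  ∀ v : Formula → Prop, IsBooleanValuation v → v Φ

end Formula

open Formula in
/-- The axioms of the first-order logic of proofs with binding modalities. The first five
clauses are the classical axioms of first-order logic. -/
inductive IsAxiom : Formula → Prop
  | taut (Φ : Formula) : IsTautology Φ → IsAxiom Φ
  | allElim (x y : Var) (Φ : Formula) : Admissible (single x y) Φ →
      IsAxiom (imp (all x Φ) (subst (single x y) Φ))
  | exIntro (x y : Var) (Φ : Formula) : Admissible (single x y) Φ →
      IsAxiom (imp (subst (single x y) Φ) (ex x Φ))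
  | allImp (x : Var) (Φ Ψ : Formula) : x ∉ Φ.FV →
      IsAxiom (imp (all x (imp Φ Ψ)) (imp Φ (all x Ψ)))
  | exImp (x : Var) (Φ Ψ : Formula) : x ∉ Φ.FV →
      IsAxiom (imp (all x (imp Ψ Φ)) (imp (ex x Ψ) Φ))
  | justDrop (t : JTerm) (X : Finset Var) (y : Var) (Φ : Formula) : y ∉ Φ.FV →
      IsAxiom (imp (just t (insert y X) Φ) (just t X Φ))
  | boxDrop (X : Finset Var) (y : Var) (Φ : Formula) : y ∉ Φ.FV →
      IsAxiom (imp (box (insert y X) Φ) (box X Φ))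
  | justAdd (t : JTerm) (X : Finset Var) (y : Var) (Φ : Formula) :
      IsAxiom (imp (just t X Φ) (just t (insert y X) Φ))
  | boxAdd (X : Finset Var) (y : Var) (Φ : Formula) :
      IsAxiom (imp (box X Φ) (box (insert y X) Φ))
  | justRefl (t : JTerm) (X : Finset Var) (Φ : Formula) : IsAxiom (imp (just t X Φ) Φ)
  | boxRefl (X : Finset Var) (Φ : Formula) : IsAxiom (imp (box X Φ) Φ)
  | justApp (t s : JTerm) (X : Finset Var) (Φ Ψ : Formula) :
      IsAxiom (imp (just t X (imp Φ Ψ)) (imp (just s X Φ) (just (JTerm.app t s) X Ψ)))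
  | boxApp (X : Finset Var) (Φ Ψ : Formula) :
      IsAxiom (imp (box X (imp Φ Ψ)) (imp (box X Φ) (box X Ψ)))
  | sumLeft (t s : JTerm) (X : Finset Var) (Φ : Formula) :
      IsAxiom (imp (just t X Φ) (just (JTerm.sum t s) X Φ))
  | sumRight (t s : JTerm) (X : Finset Var) (Φ : Formula) :
      IsAxiom (imp (just s X Φ) (just (JTerm.sum t s) X Φ))
  | justBang (t : JTerm) (X : Finset Var) (Φ : Formula) :
      IsAxiom (imp (just t X Φ) (just (JTerm.bang t) X (just t X Φ)))
  | boxTrans (X : Finset Var) (Φ : Formula) :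
      IsAxiom (imp (box X Φ) (box X (box X Φ)))
  | justGen (t : JTerm) (X : Finset Var) (x : Var) (Φ : Formula) : x ∉ X →
      IsAxiom (imp (just t X Φ) (just (JTerm.gen x t) X (all x Φ)))
  | boxGen (X : Finset Var) (x : Var) (Φ : Formula) : x ∉ X →
      IsAxiom (imp (box X Φ) (box X (all x Φ)))
  | justBox (t : JTerm) (X : Finset Var) (Φ : Formula) :
      IsAxiom (imp (just t X Φ) (box X Φ))

/-- A constant specification is a set of formulas `c :_∅ A` with `c` a justification constant and
`A` an axiom. -/
def IsConstantSpecification (CS : Set Formula) : Prop :=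
  ∀ Ψ ∈ CS, ∃ (c : ℕ) (A : Formula), IsAxiom A ∧ Ψ = Formula.just (JTerm.const c) ∅ A

/-- `Derivable CS Γ Φ`: the formula `Φ` is derivable from the hypotheses `Γ` in the logic with
constant specification `CS`. Generalization is applied only to variables not free in the
hypotheses, and necessitation only to axioms. -/
inductive Derivable (CS Γ : Set Formula) : Formula → Prop
  | hyp (Φ : Formula) : Φ ∈ Γ → Derivable CS Γ Φ
  | ax (Φ : Formula) : IsAxiom Φ → Derivable CS Γ Φ
  | cs (Φ : Formula) : Φ ∈ CS → Derivable CS Γ Φ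
  | mp (Φ Ψ : Formula) : Derivable CS Γ Φ → Derivable CS Γ (Formula.imp Φ Ψ) → Derivable CS Γ Ψ
  | gen (x : Var) (Φ : Formula) : (∀ Ψ ∈ Γ, x ∉ Ψ.FV) → Derivable CS Γ Φ →
      Derivable CS Γ (Formula.all x Φ)
  | nec (Φ : Formula) : IsAxiom Φ → Derivable CS Γ (Formula.box ∅ Φ)

/-- A finite valuation of individual variables in `U`: a partial function with finite domain. -/
@[ext]
structure FinVal (U : Type) : Type where
  toFun : Var → Option U
  finite : {x | toFun x ≠ none}.Finite

namespace FinVal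

variable {U : Type}

/-- The domain of a finite valuation. -/
def Dom (f : FinVal U) : Set Var := {x | f.toFun x ≠ none}

/-- All values of `f` lie in `A`. -/
def ImIn (f : FinVal U) (A : Set U) : Prop := ∀ x d, f.toFun x = some d → d ∈ A

/-- `f.Le g`: the valuation `g` extends `f`. -/
def Le (f g : FinVal U) : Prop := ∀ x d, f.toFun x = some d → g.toFun x = some d

/-- The empty valuation. -/
def empty : FinVal U where
  toFun := fun _ => none
  finite := by simp

/-- The restriction of `f` to `S ∩ Dom f`. -/
def restrict (f : FinVal U) (S : Finset Var) : FinVal U where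
  toFun := fun x => if x ∈ S then f.toFun x else none
  finite := S.finite_toSet.subset (fun x hx => by
    by_contra h
    exact hx (if_neg h))

/-- The composition of `f` with the substitution `σ` of the variables in `S`: its domain consists
of the `x ∈ S` with `σ x ∈ Dom f`, and it sends such an `x` to `f (σ x)`. -/
def comp (f : FinVal U) (σ : Var → Var) (S : Finset Var) : FinVal U where
  toFun := fun x => if x ∈ S then f.toFun (σ x) else none
  finite := S.finite_toSet.subset (fun x hx => by
    by_contra h
    exact hx (if_neg h))

/-- The restriction of a valuation of all variables to the finite set `S`. -/
def ofVal (ν : Var → U) (S : Finset Var) : FinVal U where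
  toFun := fun x => if x ∈ S then some (ν x) else none
  finite := S.finite_toSet.subset (fun x hx => by
    by_contra h
    exact hx (if_neg h))

end FinVal

/-- Fitting models. The type `U` is the union of the domains of the worlds. -/
structure FittingModel : Type 1 where
  W : Type
  U : Type
  R : W → W → Prop
  D : W → Set U
  I : (n i : ℕ) → W → Set (Fin n → U)
  E : JTerm → Formula → FinVal U → Set W
  nonempty_W : Nonempty W
  refl_R : ∀ w, R w w
  trans_R : ∀ w u v, R w u → R u v → R w v
  nonempty_D : ∀ w, (D w).Nonempty
  union_D : ∀ a : U, ∃ w, a ∈ D w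
  mono_D : ∀ w u, R w u → D w ⊆ D u
  I_subset : ∀ n i w, ∀ a ∈ I n i w, ∀ k, a k ∈ D w
  E_adequacy : ∀ t Φ f w, w ∈ E t Φ f → f.ImIn (D w)
  /-- `σ` may replace free variables of `Φ` only by variables on which `f` is defined, and it
  leaves the other free variables of `Φ` unchanged. -/
  E_subst : ∀ t (Φ : Formula) (σ : Var → Var) (f : FinVal U), Φ.Admissible σ →
    (∀ x ∈ Φ.FV, σ x ≠ x → σ x ∈ f.Dom) →
    E t (Φ.subst σ) (f.restrict (Φ.subst σ).FV) = E t Φ (f.comp σ Φ.FV)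
  E_closure : ∀ t Φ f w u, R w u → w ∈ E t Φ f → u ∈ E t Φ f
  E_extension : ∀ t Φ (f g : FinVal U) w, f.Le g → g.ImIn (D w) → w ∈ E t Φ f → w ∈ E t Φ g
  E_restriction : ∀ t Φ f, E t Φ f ⊆ E t Φ (f.restrict Φ.FV)
  E_app : ∀ t s Φ Ψ f, E t (Formula.imp Φ Ψ) f ∩ E s Φ f ⊆ E (JTerm.app t s) Ψ f
  E_sum : ∀ t s Φ f, E t Φ f ∪ E s Φ f ⊆ E (JTerm.sum t s) Φ f
  E_bang : ∀ t Φ (f g : FinVal U) (X : Finset Var) w, w ∈ E t Φ f → f.Le g → g.ImIn (D w) →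
    f.Dom ∩ ↑Φ.FV ⊆ (X : Set Var) → (X : Set Var) ⊆ g.Dom →
    w ∈ E (JTerm.bang t) (Formula.just t X Φ) g
  E_gen : ∀ t Φ (f : FinVal U) x, x ∉ f.Dom ∩ (Φ.FV : Set Var) →
    E t Φ f ⊆ E (JTerm.gen x t) (Formula.all x Φ) f

namespace FittingModel

/-- The model meets the constant specification `CS`. -/
def Meets (M : FittingModel) (CS : Set Formula) : Prop :=
  ∀ (c : ℕ) (Φ : Formula), Formula.just (JTerm.const c) ∅ Φ ∈ CS →
    M.E (JTerm.const c) Φ FinVal.empty = Set.univ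

/-- `ν` maps all variables of the finite set `S` to the domain of the world `w`. -/
def Lives (M : FittingModel) (ν : Var → M.U) (S : Finset Var) (w : M.W) : Prop :=
  ∀ x ∈ S, ν x ∈ M.D w

/-- `M.Sat Φ ν w`: the formula `Φ` is true at the world `w` of `M` under the valuation `ν`.
The clauses for `∨`, `→`, `↔`, `∃` are those obtained by expressing these symbols
through `¬`, `∧`, `∀` in the standard way. -/
def Sat (M : FittingModel) : Formula → (Var → M.U) → M.W → Prop
  | Formula.atom n i xs, ν, w => (fun k => ν (xs k)) ∈ M.I n i w
  | Formula.neg Φ, ν, w => M.Lives ν Φ.FV w ∧ ¬ M.Sat Φ ν w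
  | Formula.conj Φ Ψ, ν, w => M.Sat Φ ν w ∧ M.Sat Ψ ν w
  | Formula.disj Φ Ψ, ν, w => M.Lives ν (Φ.FV ∪ Ψ.FV) w ∧ (M.Sat Φ ν w ∨ M.Sat Ψ ν w)
  | Formula.imp Φ Ψ, ν, w => M.Lives ν (Φ.FV ∪ Ψ.FV) w ∧ (M.Sat Φ ν w → M.Sat Ψ ν w)
  | Formula.iff Φ Ψ, ν, w => M.Lives ν (Φ.FV ∪ Ψ.FV) w ∧ (M.Sat Φ ν w ↔ M.Sat Ψ ν w)
  | Formula.all x Φ, ν, w => ∀ a ∈ M.D w, M.Sat Φ (Function.update ν x a) w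
  | Formula.ex x Φ, ν, w =>
      M.Lives ν (Φ.FV.erase x) w ∧ ∃ a ∈ M.D w, M.Sat Φ (Function.update ν x a) w
  | Formula.box X Φ, ν, w =>
      M.Lives ν X w ∧
      ∀ u, M.R w u → ∀ μ : Var → M.U, (∀ y, y ∉ Φ.FV \ X → μ y = ν y) →
        (∀ y ∈ Φ.FV \ X, μ y ∈ M.D u) → M.Sat Φ μ u
  | Formula.just t X Φ, ν, w =>
      M.Lives ν X w ∧
      (∀ u, M.R w u → ∀ μ : Var → M.U, (∀ y, y ∉ Φ.FV \ X → μ y = ν y) →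
        (∀ y ∈ Φ.FV \ X, μ y ∈ M.D u) → M.Sat Φ μ u) ∧
      w ∈ M.E t Φ (FinVal.ofVal ν (Φ.FV ∩ X))

end FittingModel

end FOLPBox

/-!
The theorem is proved by a canonical model construction. To avoid a second syntax with parameters, a
sentence with parameters is represented by a *closure*: a formula together with a valuation of its
variables by parameters, which are natural numbers. A closure `(Φ, ν)` becomes a formula once an
injective map `ρ` from parameters to variables is chosen, namely `tr ρ (Φ, ν) = Φ.subst (ρ ∘ ν)`.
Since every bound variable of `Φ` may be avoided by `ρ`, this substitution is admissible for all
sufficiently fresh `ρ`; "sufficiently fresh" is expressed by the filter `fresh`. A set of closures is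
consistent if no finite part of it has contradictory translations for all sufficiently fresh `ρ`.

Derivability without hypotheses enters only through a few closure properties: theorems are closed
under necessitation (`Prov.nec`), under substitution of fresh variables (`Prov.subst_fresh`), and the
bound variables of `∀` and of `□_X` can be renamed. Renaming is reduced to single variables by
`subst_induction`.

A world is a coinfinite set `D` of parameters with a maximal consistent set of closures over `D` having
the Henkin property. `Consistent.exists_world` is the Lindenbaum lemma: new parameters are taken
from an infinite and coinfinite subset of the complement of `D`, one for each Henkin axiom
`Φ(c) → ∀x Φ(x)`. The successor of `w` refuting `□_X Φ` (`World.exists_rel_of_not_mem_box`) contains all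
boxed closures of `w` and the negation of `Φ` with distinct new parameters at the variables outside
`X`. Consistency of this set holds because such parameters correspond to variables bound by `□_X`.

A world `w` belongs to `E(t, Φ, f)` if `f` takes values in the domain of `w` and the closure of
`t :_X Φ` under `f` belongs to `w`, with `X = Dom f ∩ FV Φ`. The substitution condition on `E` holds since
both sides refer to closures with equal translations (`canonicalE_subst`); each of the other conditions
is one of the axioms about justifications. Truth and membership are then equivalent
(`sat_canonicalModel_iff`).
-/

namespace FOLPBox

open Formula Filter

variable {CS H H' : Set Formula}

/-! ### Variables and simultaneous substitution -/

namespace Formula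

/-- All variables occurring in a formula: free, bound, or in an index. -/
def vars : Formula → Finset Var
  | atom _ _ xs => Finset.univ.image xs
  | neg Φ => Φ.vars
  | conj Φ Ψ => Φ.vars ∪ Ψ.vars
  | disj Φ Ψ => Φ.vars ∪ Ψ.vars
  | imp Φ Ψ => Φ.vars ∪ Ψ.vars
  | iff Φ Ψ => Φ.vars ∪ Ψ.vars
  | all x Φ => insert x Φ.vars
  | ex x Φ => insert x Φ.vars
  | box X Φ => X ∪ Φ.vars
  | just _ X Φ => X ∪ Φ.vars

lemma FV_subset_vars (Φ : Formula) : Φ.FV ⊆ Φ.vars := by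
  induction Φ with
  | atom n i xs => exact subset_rfl
  | neg Φ ih => exact ih
  | conj Φ Ψ h1 h2 => exact Finset.union_subset_union h1 h2
  | disj Φ Ψ h1 h2 => exact Finset.union_subset_union h1 h2
  | imp Φ Ψ h1 h2 => exact Finset.union_subset_union h1 h2
  | iff Φ Ψ h1 h2 => exact Finset.union_subset_union h1 h2
  | all x Φ ih =>
      exact (Finset.erase_subset _ _).trans (ih.trans (Finset.subset_insert _ _))
  | ex x Φ ih =>
      exact (Finset.erase_subset _ _).trans (ih.trans (Finset.subset_insert _ _))
  | box X Φ ih => exact Finset.subset_union_left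
  | just t X Φ ih => exact Finset.subset_union_left

lemma restrictSubst_congr {X : Finset Var} {σ τ : Var → Var} (h : ∀ z ∈ X, σ z = τ z) :
    restrictSubst X σ = restrictSubst X τ := by
  funext z
  by_cases hz : z ∈ X <;> simp [restrictSubst, hz, h]

lemma update_congr_on {x : Var} {Φ : Formula} {σ τ : Var → Var}
    (h : ∀ z ∈ Φ.FV.erase x, σ z = τ z) :
    ∀ z ∈ Φ.FV, Function.update σ x x z = Function.update τ x x z := by
  intro z hz
  by_cases hx : z = x
  · simp [hx]
  · simp [hx, h z (Finset.mem_erase.2 ⟨hx, hz⟩)]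

lemma subst_congr {Φ : Formula} {σ τ : Var → Var} (h : ∀ z ∈ Φ.FV, σ z = τ z) :
    subst σ Φ = subst τ Φ := by
  induction Φ generalizing σ τ with
  | atom n i xs =>
      simp only [subst]
      congr 1
      funext k
      exact h _ (Finset.mem_image_of_mem _ (Finset.mem_univ k))
  | neg Φ ih => simp only [subst, ih h]
  | conj Φ Ψ h1 h2 | disj Φ Ψ h1 h2 | imp Φ Ψ h1 h2 | iff Φ Ψ h1 h2 =>
      simp only [subst, h1 fun z hz => h z (Finset.mem_union_left _ hz),
        h2 fun z hz => h z (Finset.mem_union_right _ hz)]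
  | all x Φ ih | ex x Φ ih => simp only [subst, ih (update_congr_on h)]
  | box X Φ ih | just t X Φ ih =>
      simp only [subst, Finset.image_congr (s := X) h, restrictSubst_congr (X := X) h]

lemma Admissible.congr {Φ : Formula} {σ τ : Var → Var} (h : ∀ z ∈ Φ.FV, σ z = τ z)
    (ha : Admissible σ Φ) : Admissible τ Φ := by
  induction Φ generalizing σ τ with
  | atom n i xs => trivial
  | neg Φ ih => exact ih h ha
  | conj Φ Ψ h1 h2 | disj Φ Ψ h1 h2 | imp Φ Ψ h1 h2 | iff Φ Ψ h1 h2 =>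
      exact ⟨h1 (fun z hz => h z (Finset.mem_union_left _ hz)) ha.1,
        h2 (fun z hz => h z (Finset.mem_union_right _ hz)) ha.2⟩
  | all x Φ ih | ex x Φ ih =>
      refine ⟨fun z hz hx => ?_, ih (update_congr_on h) ha.2⟩
      rw [← h z (Finset.mem_erase.2 ⟨hx, hz⟩)]
      exact ha.1 z hz hx
  | box X Φ ih | just t X Φ ih =>
      refine ⟨fun z hz => ?_, ?_⟩
      · rw [← h z hz]
        exact ha.1 z hz
      · rw [← restrictSubst_congr (X := X) h]
        exact ha.2

@[simp] lemma restrictSubst_id (X : Finset Var) : restrictSubst X id = id := by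
  funext z
  simp [restrictSubst]

lemma subst_id (Φ : Formula) : subst id Φ = Φ := by
  have hu : ∀ x : Var, Function.update (id : Var → Var) x x = id := fun x =>
    Function.update_eq_self x id
  induction Φ with
  | atom n i xs => rfl
  | neg Φ ih => simp only [subst, ih]
  | conj Φ Ψ h1 h2 | disj Φ Ψ h1 h2 | imp Φ Ψ h1 h2 | iff Φ Ψ h1 h2 => simp only [subst, h1, h2]
  | all x Φ ih | ex x Φ ih => simp only [subst, hu, ih]
  | box X Φ ih | just t X Φ ih => simp only [subst, restrictSubst_id, ih, Finset.image_id]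

lemma subst_of_closed {Φ : Formula} (h : Φ.Closed) (σ : Var → Var) : subst σ Φ = Φ := by
  rw [← subst_congr (σ := id) (τ := σ), subst_id]
  intro z hz
  rw [h] at hz
  simp at hz

lemma single_self (x : Var) : single x x = id := Function.update_eq_self x id

/-- A substitution is admissible as soon as each variable that it really moves goes to a variable
that does not occur in the formula. -/
lemma admissible_of_fresh {Φ : Formula} {σ : Var → Var}
    (h : ∀ z ∈ Φ.FV, σ z = z ∨ σ z ∉ Φ.vars) : Admissible σ Φ := by
  induction Φ generalizing σ with
  | atom n i xs => trivial
  | neg Φ ih => exact ih h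
  | conj Φ Ψ h1 h2 | disj Φ Ψ h1 h2 | imp Φ Ψ h1 h2 | iff Φ Ψ h1 h2 =>
      exact ⟨h1 fun z hz => (h z (Finset.mem_union_left _ hz)).imp_right
          fun h' h'' => h' (Finset.mem_union_left _ h''),
        h2 fun z hz => (h z (Finset.mem_union_right _ hz)).imp_right
          fun h' h'' => h' (Finset.mem_union_right _ h'')⟩
  | all x Φ ih | ex x Φ ih =>
      refine ⟨fun z hz hx hσ => ?_, ih fun z hz => ?_⟩
      · rcases h z (Finset.mem_erase.2 ⟨hx, hz⟩) with h' | h'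
        · exact hx (h' ▸ hσ)
        · exact h' (hσ ▸ Finset.mem_insert_self _ _)
      · by_cases hx : z = x
        · simp [hx]
        · rw [Function.update_of_ne hx]
          exact (h z (Finset.mem_erase.2 ⟨hx, hz⟩)).imp_right
            fun h' h'' => h' (Finset.mem_insert_of_mem h'')
  | box X Φ ih | just t X Φ ih =>
      refine ⟨fun z hz hσ => ?_, ih fun z hz => ?_⟩
      · rw [Finset.mem_sdiff] at hσ
        rcases h z hz with h' | h'
        · exact hσ.2 (h'.symm ▸ hz)
        · exact h' (Finset.mem_union_right _ (FV_subset_vars _ hσ.1))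
      · by_cases hX : z ∈ X
        · simp only [restrictSubst, hX, if_true]
          exact (h z hX).imp_right fun h' h'' => h' (Finset.mem_union_right _ h'')
        · simp [restrictSubst, hX]

lemma FV_subst_subset (Φ : Formula) (σ : Var → Var) : (subst σ Φ).FV ⊆ Φ.FV.image σ := by
  induction Φ generalizing σ with
  | atom n i xs =>
      intro z
      simp [subst, FV]
  | neg Φ ih => exact ih σ
  | conj Φ Ψ h1 h2 | disj Φ Ψ h1 h2 | imp Φ Ψ h1 h2 | iff Φ Ψ h1 h2 =>
      simp only [subst, FV, Finset.image_union]
      exact Finset.union_subset_union (h1 σ) (h2 σ)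
  | all x Φ ih | ex x Φ ih =>
      intro z hz
      simp only [subst, FV, Finset.mem_erase] at hz
      obtain ⟨y, hy, rfl⟩ := Finset.mem_image.1 (ih _ hz.2)
      have hx : y ≠ x := by
        rintro rfl
        simp at hz
      rw [Function.update_of_ne hx]
      exact Finset.mem_image_of_mem _ (Finset.mem_erase.2 ⟨hx, hy⟩)
  | box X Φ ih | just t X Φ ih => exact subset_rfl

lemma FV_subst {Φ : Formula} {σ : Var → Var} (ha : Admissible σ Φ) :
    (subst σ Φ).FV = Φ.FV.image σ := by
  refine (FV_subst_subset Φ σ).antisymm ?_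
  induction Φ generalizing σ with
  | atom n i xs =>
      intro z
      simp [subst, FV]
  | neg Φ ih => exact ih ha
  | conj Φ Ψ h1 h2 | disj Φ Ψ h1 h2 | imp Φ Ψ h1 h2 | iff Φ Ψ h1 h2 =>
      simp only [subst, FV, Finset.image_union]
      exact Finset.union_subset_union (h1 ha.1) (h2 ha.2)
  | all x Φ ih | ex x Φ ih =>
      intro z hz
      obtain ⟨y, hy, rfl⟩ := Finset.mem_image.1 hz
      obtain ⟨hx, hy⟩ := Finset.mem_erase.1 hy
      refine Finset.mem_erase.2 ⟨ha.1 y hy hx, ih ha.2 ?_⟩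
      rw [← Function.update_of_ne hx x σ]
      exact Finset.mem_image_of_mem _ hy
  | box X Φ ih | just t X Φ ih => exact subset_rfl

lemma update_comp_on {x : Var} {Φ : Formula} {σ : Var → Var} (τ : Var → Var)
    (h : ∀ z ∈ Φ.FV, z ≠ x → σ z ≠ x) :
    ∀ z ∈ Φ.FV, Function.update (τ ∘ σ) x x z =
      (Function.update τ x x ∘ Function.update σ x x) z := by
  intro z hz
  by_cases hx : z = x
  · simp [hx]
  · simp [hx, h z hz hx]

lemma restrictSubst_comp_on {X : Finset Var} {Φ : Formula} {σ : Var → Var} (τ : Var → Var)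
    (h : ∀ z ∈ X, σ z ∉ Φ.FV \ X) :
    ∀ z ∈ Φ.FV, restrictSubst X (τ ∘ σ) z =
      (restrictSubst (X.image σ) τ ∘ restrictSubst X σ) z := by
  intro z hz
  by_cases hX : z ∈ X
  · simp only [restrictSubst, hX, if_true, Function.comp, Finset.mem_image_of_mem σ hX]
  · have : z ∉ X.image σ := by
      intro hm
      obtain ⟨y, hy, rfl⟩ := Finset.mem_image.1 hm
      exact h y hy (Finset.mem_sdiff.2 ⟨hz, hX⟩)
    simp only [restrictSubst, hX, if_false, Function.comp, this]

lemma subst_comp {Φ : Formula} {σ : Var → Var} (ha : Admissible σ Φ) (τ : Var → Var) :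
    subst τ (subst σ Φ) = subst (τ ∘ σ) Φ := by
  induction Φ generalizing σ τ with
  | atom n i xs => rfl
  | neg Φ ih => simp only [subst, ih ha]
  | conj Φ Ψ h1 h2 | disj Φ Ψ h1 h2 | imp Φ Ψ h1 h2 | iff Φ Ψ h1 h2 =>
      simp only [subst, h1 ha.1, h2 ha.2]
  | all x Φ ih | ex x Φ ih => simp only [subst, ih ha.2, subst_congr (update_comp_on τ ha.1)]
  | box X Φ ih | just t X Φ ih =>
      simp only [subst, ih ha.2, subst_congr (restrictSubst_comp_on τ ha.1), Finset.image_image]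

lemma Admissible.of_comp {Φ : Formula} {σ τ : Var → Var} (ha : Admissible σ Φ)
    (hc : Admissible (τ ∘ σ) Φ) : Admissible τ (subst σ Φ) := by
  induction Φ generalizing σ τ with
  | atom n i xs => trivial
  | neg Φ ih => exact ih ha hc
  | conj Φ Ψ h1 h2 | disj Φ Ψ h1 h2 | imp Φ Ψ h1 h2 | iff Φ Ψ h1 h2 =>
      exact ⟨h1 ha.1 hc.1, h2 ha.2 hc.2⟩
  | all x Φ ih | ex x Φ ih =>
      refine ⟨fun z hz hx => ?_, ih ha.2 (hc.2.congr (update_comp_on τ ha.1))⟩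
      obtain ⟨y, hy, rfl⟩ := Finset.mem_image.1 (FV_subst_subset _ _ hz)
      have hyx : y ≠ x := by
        rintro rfl
        simp at hx
      rw [Function.update_of_ne hyx]
      exact hc.1 y hy hyx
  | box X Φ ih | just t X Φ ih =>
      refine ⟨fun z hz hm => ?_, ih ha.2 (hc.2.congr (restrictSubst_comp_on τ ha.1))⟩
      obtain ⟨y, hy, rfl⟩ := Finset.mem_image.1 hz
      obtain ⟨hm, hn⟩ := Finset.mem_sdiff.1 hm
      obtain ⟨q, hq, hqe⟩ := Finset.mem_image.1 (FV_subst_subset _ _ hm)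
      by_cases hX : q ∈ X
      · apply hn
        rw [← hqe]
        simp only [restrictSubst, hX, if_true]
        exact Finset.mem_image_of_mem _ hX
      · simp only [restrictSubst, hX, if_false] at hqe
        exact hc.1 y hy (by simp only [Function.comp, ← hqe]; exact Finset.mem_sdiff.2 ⟨hq, hX⟩)

/-- One step in the passage from one substitution to another: if no other free variable shares
the value `σ x`, replacing that value by `y` changes `σ` at `x` only. -/
lemma subst_single_subst {Φ : Formula} {σ : Var → Var} {x y : Var} (ha : Admissible σ Φ)
    (hu : Admissible (Function.update σ x y) Φ) (hx : ∀ z ∈ Φ.FV, z ≠ x → σ z ≠ σ x) :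
    Admissible (single (σ x) y) (subst σ Φ) ∧
      subst (single (σ x) y) (subst σ Φ) = subst (Function.update σ x y) Φ := by
  have h : ∀ z ∈ Φ.FV, Function.update σ x y z = (single (σ x) y ∘ σ) z := by
    intro z hz
    by_cases hzx : z = x
    · simp [hzx, single]
    · simp [hzx, single, hx z hz hzx]
  refine ⟨ha.of_comp (hu.congr h), ?_⟩
  rw [subst_comp ha, subst_congr h]

end Formula

/-! ### Derived rules of the logic -/

/-- Theorems of the logic: formulas derivable without hypotheses. -/
abbrev Prov (CS : Set Formula) (Φ : Formula) : Prop := Derivable CS ∅ Φ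

/-- Consequence from a set of hypotheses by modus ponens and theorems only. No rule touches the
variables or the modalities, so the deduction theorem holds without restrictions. -/
inductive Ded (CS H : Set Formula) : Formula → Prop
  | hyp {Φ : Formula} : Φ ∈ H → Ded CS H Φ
  | thm {Φ : Formula} : Prov CS Φ → Ded CS H Φ
  | mp {Φ Ψ : Formula} : Ded CS H (imp Φ Ψ) → Ded CS H Φ → Ded CS H Ψ

/-- A closed contradiction. -/
def bot : Formula := conj (atom 0 0 Fin.elim0) (neg (atom 0 0 Fin.elim0))

lemma Prov.mp {Φ Ψ : Formula} (h : Prov CS (imp Φ Ψ)) (h' : Prov CS Φ) : Prov CS Ψ :=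
  Derivable.mp _ _ h' h

lemma Prov.ofAxiom {Φ : Formula} (h : IsAxiom Φ) : Prov CS Φ := Derivable.ax _ h

lemma Prov.taut {Φ : Formula} (h : IsTautology Φ) : Prov CS Φ := .ofAxiom (.taut _ h)

lemma Prov.gen {Φ : Formula} (x : Var) (h : Prov CS Φ) : Prov CS (all x Φ) :=
  Derivable.gen _ _ (fun _ h => absurd h (Set.notMem_empty _)) h

lemma Ded.mono (hH : H ⊆ H') {Φ : Formula} (h : Ded CS H Φ) : Ded CS H' Φ := by
  induction h with
  | hyp h => exact .hyp (hH h)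
  | thm h => exact .thm h
  | mp _ _ h1 h2 => exact .mp h1 h2

lemma Ded.prov {Φ : Formula} (h : Ded CS ∅ Φ) : Prov CS Φ := by
  induction h with
  | hyp h => exact absurd h (Set.notMem_empty _)
  | thm h => exact h
  | mp _ _ h1 h2 => exact h1.mp h2

/-- A Boolean consequence of a derivable formula is derivable. -/
lemma Ded.taut1 {A B : Formula} (hA : Ded CS H A)
    (h : ∀ v, IsBooleanValuation v → v A → v B) : Ded CS H B :=
  .mp (.thm (.taut fun v hv => (hv.imp _ _).2 (h v hv))) hA

lemma Ded.taut2 {A B C : Formula} (hA : Ded CS H A) (hB : Ded CS H B)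
    (h : ∀ v, IsBooleanValuation v → v A → v B → v C) : Ded CS H C :=
  .mp (hA.taut1 fun v hv ha => (hv.imp _ _).2 (h v hv ha)) hB

lemma Prov.trans {A B C : Formula} (h1 : Prov CS (imp A B)) (h2 : Prov CS (imp B C)) :
    Prov CS (imp A C) :=
  (Ded.taut2 (H := ∅) (.thm h1) (.thm h2) fun v hv => by simp only [hv.imp]; tauto).prov

lemma Prov.imp_self (A : Formula) : Prov CS (imp A A) :=
  .taut fun _ hv => (hv.imp _ _).2 id

lemma Ded.deduction {A B : Formula} (h : Ded CS (insert A H) B) : Ded CS H (imp A B) := by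
  induction h with
  | @hyp Φ h =>
    rcases h with rfl | h
    · exact .thm (.imp_self _)
    · exact (Ded.hyp h).taut1 fun v hv => by simp only [hv.imp]; tauto
  | thm h => exact (Ded.thm h).taut1 fun v hv => by simp only [hv.imp]; tauto
  | mp _ _ h1 h2 => exact h1.taut2 h2 fun v hv => by simp only [hv.imp]; tauto

lemma Prov.gen_imp {A B : Formula} {x : Var} (hx : x ∉ A.FV) (h : Prov CS (imp A B)) :
    Prov CS (imp A (all x B)) :=
  Prov.mp (.ofAxiom (.allImp x A B hx)) (h.gen x)

lemma Prov.all_elim (x y : Var) {Φ : Formula} (h : Admissible (single x y) Φ) :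
    Prov CS (imp (all x Φ) (subst (single x y) Φ)) :=
  .ofAxiom (.allElim x y Φ h)

lemma admissible_single_self (x : Var) (Φ : Formula) : Admissible (single x x) Φ :=
  admissible_of_fresh fun z _ => by simp [single_self]

lemma Prov.all_elim_self (x : Var) (Φ : Formula) : Prov CS (imp (all x Φ) Φ) := by
  have h := Prov.all_elim (CS := CS) x x (admissible_single_self x Φ)
  rwa [single_self, subst_id] at h

lemma Prov.ex_intro_self (x : Var) (Φ : Formula) : Prov CS (imp Φ (ex x Φ)) := by
  have h : Prov CS _ := .ofAxiom (.exIntro x x Φ (admissible_single_self x Φ))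
  rwa [single_self, subst_id] at h

lemma Prov.all_distrib (x : Var) (A B : Formula) :
    Prov CS (imp (all x (imp A B)) (imp (all x A) (all x B))) := by
  have h : Prov CS (imp (conj (all x (imp A B)) (all x A)) B) :=
    (Ded.taut2 (H := ∅) (.thm (.all_elim_self x (imp A B))) (.thm (.all_elim_self x A))
      fun v hv => by simp only [hv.imp, hv.conj]; tauto).prov
  have h' := Prov.gen_imp (x := x) (by simp [FV]) h
  exact (Ded.taut1 (H := ∅) (.thm h') fun v hv => by simp only [hv.imp, hv.conj]; tauto).prov

/-- `∃` and `∀` are interdefinable. -/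
lemma Prov.ex_iff (x : Var) (Φ : Formula) :
    Prov CS (iff (ex x Φ) (neg (all x (neg Φ)))) := by
  have h1 : Prov CS (imp Φ (neg (all x (neg Φ)))) :=
    (Ded.taut1 (H := ∅) (.thm (.all_elim_self x (neg Φ)))
      fun v hv => by simp only [hv.imp, hv.neg]; tauto).prov
  have h2 : Prov CS (imp (ex x Φ) (neg (all x (neg Φ)))) :=
    Prov.mp (.ofAxiom (.exImp x _ Φ (by simp [FV]))) (h1.gen x)
  have h3 : Prov CS (imp (neg (ex x Φ)) (neg Φ)) :=
    (Ded.taut1 (H := ∅) (.thm (.ex_intro_self x Φ))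
      fun v hv => by simp only [hv.imp, hv.neg]; tauto).prov
  have h4 := Prov.gen_imp (x := x) (by simp [FV]) h3
  exact (Ded.taut2 (H := ∅) (.thm h2) (.thm h4)
    fun v hv => by simp only [hv.imp, hv.neg, hv.iff]; tauto).prov

/-- Generalization on a variable that is not free in the hypotheses. -/
lemma Ded.gen {x : Var} {B : Formula} (hx : ∀ A ∈ H, x ∉ A.FV) (h : Ded CS H B) :
    Ded CS H (all x B) := by
  induction h with
  | hyp h => exact .mp (.thm (Prov.gen_imp (hx _ h) (.imp_self _))) (.hyp h)
  | thm h => exact .thm (h.gen x)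
  | mp _ _ h1 h2 => exact .mp (.mp (.thm (.all_distrib x _ _)) h1) h2

/-- The index of an operator can be enlarged at will once it can be enlarged by one variable. -/
lemma Prov.index_mono {op : Finset Var → Formula}
    (h : ∀ X y, Prov CS (imp (op X) (op (insert y X)))) {X Y : Finset Var} (hXY : X ⊆ Y) :
    Prov CS (imp (op X) (op Y)) := by
  have key : ∀ Z : Finset Var, Prov CS (imp (op X) (op (Z ∪ X))) := by
    intro Z
    induction Z using Finset.induction_on with
    | empty => simpa using Prov.imp_self _
    | insert y Z _ ih =>
      rw [Finset.insert_union]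
      exact ih.trans (h _ _)
  simpa [Finset.union_eq_left.2 hXY] using key Y

/-- Variables outside `S` can be dropped from the index of an operator once this is possible for one
variable at a time. -/
lemma Prov.index_drop {op : Finset Var → Formula} {S : Finset Var}
    (h : ∀ X y, y ∉ S → Prov CS (imp (op (insert y X)) (op X))) {X Y : Finset Var} (hXY : X ⊆ Y)
    (hS : ∀ y ∈ Y, y ∉ X → y ∉ S) : Prov CS (imp (op Y) (op X)) := by
  have key : ∀ Z : Finset Var, (∀ y ∈ Z, y ∉ S) → Prov CS (imp (op (Z ∪ X)) (op X)) := by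
    intro Z
    induction Z using Finset.induction_on with
    | empty => intro _; simpa using Prov.imp_self _
    | insert y Z _ ih =>
      intro hZ
      rw [Finset.insert_union]
      exact (h _ y (hZ y (Finset.mem_insert_self _ _))).trans
        (ih fun z hz => hZ z (Finset.mem_insert_of_mem hz))
  have h' := key (Y \ X) fun y hy => hS y (Finset.mem_sdiff.1 hy).1 (Finset.mem_sdiff.1 hy).2
  rwa [Finset.sdiff_union_of_subset hXY] at h'

lemma Prov.box_mono {X Y : Finset Var} (hXY : X ⊆ Y) (Φ : Formula) :
    Prov CS (imp (box X Φ) (box Y Φ)) :=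
  Prov.index_mono (op := fun X => box X Φ) (fun X y => .ofAxiom (.boxAdd X y Φ)) hXY

lemma Prov.just_mono {X Y : Finset Var} (hXY : X ⊆ Y) (t : JTerm) (Φ : Formula) :
    Prov CS (imp (just t X Φ) (just t Y Φ)) :=
  Prov.index_mono (op := fun X => just t X Φ) (fun X y => .ofAxiom (.justAdd t X y Φ)) hXY

lemma Prov.box_drop {X Y : Finset Var} {Φ : Formula} (hXY : X ⊆ Y)
    (hS : ∀ y ∈ Y, y ∉ X → y ∉ Φ.FV) : Prov CS (imp (box Y Φ) (box X Φ)) :=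
  Prov.index_drop (op := fun X => box X Φ) (fun X y hy => .ofAxiom (.boxDrop X y Φ hy)) hXY hS

lemma Prov.just_drop {X Y : Finset Var} {t : JTerm} {Φ : Formula} (hXY : X ⊆ Y)
    (hS : ∀ y ∈ Y, y ∉ X → y ∉ Φ.FV) : Prov CS (imp (just t Y Φ) (just t X Φ)) :=
  Prov.index_drop (op := fun X => just t X Φ) (fun X y hy => .ofAxiom (.justDrop t X y Φ hy))
    hXY hS

/-- Necessitation for all theorems, not only for axioms. -/
lemma Prov.nec (hCS : IsConstantSpecification CS) {Φ : Formula} (h : Prov CS Φ) :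
    Prov CS (box ∅ Φ) := by
  induction h with
  | hyp Φ h => exact absurd h (Set.notMem_empty _)
  | ax Φ h => exact Derivable.nec _ h
  | cs Φ h =>
    obtain ⟨c, A, -, rfl⟩ := hCS Φ h
    exact Prov.mp (.ofAxiom (.justBox _ _ _))
      (Prov.mp (.ofAxiom (.justBang _ _ _)) (Derivable.cs _ h))
  | mp Φ Ψ _ _ h1 h2 => exact Prov.mp (Prov.mp (.ofAxiom (.boxApp _ _ _)) h2) h1
  | gen x Φ _ _ ih => exact Prov.mp (.ofAxiom (.boxGen _ _ _ (Finset.notMem_empty _))) ih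
  | nec Φ h =>
    exact Prov.mp (.ofAxiom (.boxTrans _ _)) (Derivable.nec _ h)

lemma Prov.nec_index (hCS : IsConstantSpecification CS) (X : Finset Var) {Φ : Formula}
    (h : Prov CS Φ) : Prov CS (box X Φ) :=
  (Prov.box_mono (Finset.empty_subset X) Φ).mp (h.nec hCS)

lemma Prov.box_imp (hCS : IsConstantSpecification CS) (X : Finset Var) {Φ Ψ : Formula}
    (h : Prov CS (imp Φ Ψ)) : Prov CS (imp (box X Φ) (box X Ψ)) :=
  Prov.mp (.ofAxiom (.boxApp _ _ _)) (h.nec_index hCS X)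

/-- Necessitation with index `Z` is allowed under hypotheses that imply their own `□_Z`. -/
lemma Ded.box (hCS : IsConstantSpecification CS) {Z : Finset Var} {B : Formula}
    (hH : ∀ A ∈ H, Ded CS H (box Z A)) (h : Ded CS H B) : Ded CS H (box Z B) := by
  induction h with
  | hyp h => exact hH _ h
  | thm h => exact .thm (h.nec_index hCS Z)
  | mp _ _ h1 h2 => exact .mp (.mp (.thm (.ofAxiom (.boxApp _ _ _))) h1) h2

lemma Prov.subst_single {x y : Var} {Φ : Formula} (ha : Admissible (single x y) Φ)
    (h : Prov CS Φ) : Prov CS (subst (single x y) Φ) :=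
  (Prov.all_elim x y ha).mp (h.gen x)

/-- A variable outside the index is bound by the modality, and may be renamed. -/
lemma Prov.box_subst_single (hCS : IsConstantSpecification CS) {Z : Finset Var} {x y : Var}
    {Φ : Formula} (hx : x ∉ Z) (ha : Admissible (single x y) Φ) :
    Prov CS (imp (Formula.box Z Φ) (Formula.box Z (subst (single x y) Φ))) :=
  (Prov.ofAxiom (.boxGen _ _ _ hx)).trans (Prov.box_imp hCS Z (.all_elim x y ha))

/-- Simultaneous substitutions are reached by single ones. Let `σ` and `τ` differ on `FV Φ` at most in
`S`. A property of formulas that is preserved when a value `σ x` with `x ∈ S` is replaced by `τ x` passes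
from `Φσ` to `Φτ`, provided that `σ x` is not a value of `σ` or `τ` at other free variables. The proof
goes through the substitutions that act as `τ` on a part of `S` and as `σ` elsewhere. -/
lemma subst_induction {Φ : Formula} {σ τ : Var → Var} {S : Finset Var} (P : Formula → Prop)
    (hσ : ∀ z ∈ Φ.FV, σ z = z ∨ σ z ∉ Φ.vars) (hτ : ∀ z ∈ Φ.FV, τ z = z ∨ τ z ∉ Φ.vars)
    (hS : ∀ z ∈ Φ.FV, z ∉ S → σ z = τ z)
    (hinj : ∀ x ∈ S, ∀ z ∈ Φ.FV, z ≠ x → σ z ≠ σ x ∧ τ z ≠ σ x)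
    (hP : ∀ Ψ, ∀ x ∈ S, Admissible (single (σ x) (τ x)) Ψ → P Ψ →
      P (subst (single (σ x) (τ x)) Ψ))
    (h : P (subst σ Φ)) : P (subst τ Φ) := by
  have key : ∀ T : Finset Var, T ⊆ S → P (subst (fun z => if z ∈ T then τ z else σ z) Φ) := by
    intro T
    induction T using Finset.induction_on with
    | empty => intro _; simpa using h
    | insert x T hxT ih =>
      intro hT
      have hxS := hT (Finset.mem_insert_self _ _)
      have e : Function.update (fun z => if z ∈ T then τ z else σ z) x (τ x) =
          fun z => if z ∈ insert x T then τ z else σ z := by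
        funext z
        by_cases hz : z = x
        · subst hz; simp
        · simp [hz]
      have adm : ∀ T : Finset Var, Admissible (fun z => if z ∈ T then τ z else σ z) Φ := by
        intro T
        refine admissible_of_fresh fun z hz => ?_
        by_cases hzT : z ∈ T
        · simpa [hzT] using hτ z hz
        · simpa [hzT] using hσ z hz
      have step := subst_single_subst (x := x) (y := τ x) (adm T) (by rw [e]; exact adm _)
        (by
          intro z hz hzx
          simp only [hxT, if_false]
          split_ifs
          · exact (hinj x hxS z hz hzx).2
          · exact (hinj x hxS z hz hzx).1)
      simp only [hxT, if_false, e] at step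
      rw [← step.2]
      exact hP _ x hxS step.1 (ih ((Finset.subset_insert _ _).trans hT))
  have := key S subset_rfl
  rwa [subst_congr (τ := τ)] at this
  intro z hz
  by_cases hzS : z ∈ S
  · simp [hzS]
  · simp [hzS, hS z hz hzS]

/-- Theorems are closed under simultaneous substitution of fresh variables. -/
lemma Prov.subst_fresh {Φ : Formula} {τ : Var → Var} (hτ : ∀ z, τ z ∉ Φ.vars) (h : Prov CS Φ) :
    Prov CS (subst τ Φ) :=
  subst_induction (σ := id) (S := Φ.FV) (Prov CS) (fun _ _ => .inl rfl) (fun z _ => .inr (hτ z))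
    (fun z hz hz' => absurd hz hz')
    (fun x hx z _ hzx => ⟨hzx, fun e => hτ z (e ▸ FV_subset_vars _ hx)⟩)
    (fun _ _ _ ha h => h.subst_single ha) (by rwa [subst_id])

/-! ### Consistent sets of closures -/

/-- The filter of embeddings of the parameters into the variables: a property holds eventually if
it holds for all injective `ρ` whose values avoid some finite set of variables. -/
def fresh : Filter (ℕ → Var) where
  sets := {s | ∃ F : Finset Var, ∀ ρ : ℕ → Var, ρ.Injective → (∀ a, ρ a ∉ F) → ρ ∈ s}
  univ_sets := ⟨∅, fun _ _ _ => trivial⟩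
  sets_of_superset := fun ⟨F, hF⟩ h => ⟨F, fun ρ h1 h2 => h (hF ρ h1 h2)⟩
  inter_sets := fun ⟨F, hF⟩ ⟨G, hG⟩ => ⟨F ∪ G, fun ρ h1 h2 =>
    ⟨hF ρ h1 fun a h => h2 a (Finset.mem_union_left _ h),
      hG ρ h1 fun a h => h2 a (Finset.mem_union_right _ h)⟩⟩

lemma eventually_injective : ∀ᶠ ρ in fresh, ρ.Injective := ⟨∅, fun _ h _ => h⟩

lemma eventually_avoid (F : Finset Var) : ∀ᶠ ρ in fresh, ∀ a, ρ a ∉ F := ⟨F, fun _ _ h => h⟩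

instance : NeBot fresh := by
  refine ⟨fun h => ?_⟩
  obtain ⟨F, hF⟩ : ∅ ∈ fresh := h ▸ mem_bot
  refine hF (fun a => a + (F.sup id + 1)) (fun a b h => by simpa using h) fun a ha => ?_
  have : a + (F.sup id + 1) ≤ F.sup id := Finset.le_sup (f := id) ha
  omega

/-- A formula whose free variables are interpreted by parameters. Parameters are natural numbers,
and closures play the role of sentences of the language expanded by the parameters. -/
abbrev Closure : Type := Formula × (Var → ℕ)

/-- The formula obtained from a closure by writing the variable `ρ a` for the parameter `a`. -/
def tr (ρ : ℕ → Var) (c : Closure) : Formula := subst (ρ ∘ c.2) c.1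

/-- All parameters occurring in the closure belong to `D`. -/
def LivesIn (D : Set ℕ) (c : Closure) : Prop := ∀ x ∈ c.1.FV, c.2 x ∈ D

lemma LivesIn.mono {D D' : Set ℕ} (h : D ⊆ D') {c : Closure} (hc : LivesIn D c) : LivesIn D' c :=
  fun x hx => h (hc x hx)

lemma tr_congr {Φ : Formula} {ν μ : Var → ℕ} (h : ∀ x ∈ Φ.FV, ν x = μ x) (ρ : ℕ → Var) :
    tr ρ (Φ, ν) = tr ρ (Φ, μ) :=
  subst_congr fun x hx => by simp only [Function.comp, h x hx]

lemma exists_of_mem_FV_tr {ρ : ℕ → Var} {c : Closure} {z : Var} (h : z ∈ (tr ρ c).FV) :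
    ∃ x ∈ c.1.FV, ρ (c.2 x) = z :=
  Finset.mem_image.1 (FV_subst_subset _ _ h)

/-- A set of closures is consistent if no finite subset of it, translated by a sufficiently fresh
embedding of the parameters, yields a contradiction. -/
def Consistent (CS : Set Formula) (S : Set Closure) : Prop :=
  ∀ L ⊆ S, L.Finite → ¬ ∀ᶠ ρ in fresh, Ded CS (tr ρ '' L) bot

lemma Ded.bot_of {H : Set Formula} {A : Formula} (h : Ded CS H A) (h' : Ded CS H (neg A)) :
    Ded CS H bot :=
  h.taut2 h' fun _ hv h1 h2 => absurd h1 ((hv.neg _).1 h2)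

lemma Ded.neg_of_bot {H : Set Formula} {A : Formula} (h : Ded CS (insert A H) bot) :
    Ded CS H (neg A) :=
  h.deduction.taut1 fun v hv => by simp only [bot, hv.imp, hv.neg, hv.conj]; tauto

lemma exists_of_not_consistent_insert {S : Set Closure} {c : Closure}
    (h : ¬ Consistent CS (insert c S)) :
    ∃ L ⊆ S, L.Finite ∧ ∀ᶠ ρ in fresh, Ded CS (tr ρ '' L) (neg (tr ρ c)) := by
  simp only [Consistent, not_forall, not_not] at h
  obtain ⟨L, hLS, hL, h⟩ := h
  refine ⟨L \ {c}, by simpa [Set.sdiff_subset_iff] using hLS, hL.subset Set.sdiff_subset, ?_⟩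
  filter_upwards [h] with ρ hρ
  refine (hρ.mono ?_).neg_of_bot
  rw [← Set.image_insert_eq, Set.insert_sdiff_singleton]
  exact Set.image_mono (Set.subset_insert _ _)

lemma Consistent.or_neg {S : Set Closure} (h : Consistent CS S) (Φ : Formula) (ν : Var → ℕ) :
    Consistent CS (insert (Φ, ν) S) ∨ Consistent CS (insert (neg Φ, ν) S) := by
  by_contra hc
  rw [not_or] at hc
  obtain ⟨L, hLS, hL, h1⟩ := exists_of_not_consistent_insert hc.1
  obtain ⟨L', hLS', hL', h2⟩ := exists_of_not_consistent_insert hc.2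
  refine h (L ∪ L') (Set.union_subset hLS hLS') (hL.union hL') ?_
  filter_upwards [h1, h2] with ρ h1 h2
  exact (h1.mono (Set.image_mono Set.subset_union_left)).bot_of
    (h2.mono (Set.image_mono Set.subset_union_right))

/-- A Henkin axiom `Φ(c) → ∀x Φ(x)` with a new parameter `c` preserves consistency. -/
lemma Consistent.insert_henkin {S : Set Closure} (h : Consistent CS S) {x : Var} {Φ : Formula}
    {ν : Var → ℕ} {c : ℕ} (hS : ∀ d ∈ S, ∀ y ∈ d.1.FV, d.2 y ≠ c)
    (hν : ∀ y ∈ Φ.FV, y ≠ x → ν y ≠ c) :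
    Consistent CS (insert (imp Φ (all x Φ), Function.update ν x c) S) := by
  by_contra hc
  obtain ⟨L, hLS, hL, h1⟩ := exists_of_not_consistent_insert hc
  refine h L hLS hL ?_
  filter_upwards [h1, eventually_injective, eventually_avoid (insert x Φ.vars)] with ρ h1 hρ hF
  set σ : Var → Var := ρ ∘ Function.update ν x c with hσ
  have hσx : σ x = ρ c := by simp [hσ]
  have h2 : Ded CS (tr ρ '' L) (subst σ Φ) :=
    h1.taut1 fun v hv => by
      simp only [tr, subst, hv.imp, hv.neg]
      tauto
  have h3 : Ded CS (tr ρ '' L) (neg (all x (subst (Function.update σ x x) Φ))) :=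
    h1.taut1 fun v hv => by
      simp only [tr, subst, hv.imp, hv.neg]
      tauto
  have hFV : ∀ A ∈ tr ρ '' L, ∀ z ∈ A.FV, z ≠ ρ c ∧ z ≠ x := by
    rintro _ ⟨d, hd, rfl⟩ z hz
    obtain ⟨y, hy, rfl⟩ := exists_of_mem_FV_tr hz
    exact ⟨fun e => hS d (hLS hd) y hy (hρ e),
      fun e => hF (d.2 y) (e ▸ Finset.mem_insert_self _ _)⟩
  have hv : ∀ z, σ z ∉ Φ.vars := fun z hz => hF _ (Finset.mem_insert_of_mem hz)
  -- The variable standing for the new parameter is generalized and then renamed to `x`.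
  have step := subst_single_subst (Φ := Φ) (σ := σ) (x := x) (y := x)
    (admissible_of_fresh fun z _ => .inr (hv z))
    (admissible_of_fresh fun z _ => by
      by_cases hz : z = x
      · simp [hz]
      · simpa [hz] using .inr (hv z))
    (fun z hz hzx e => hν z hz hzx (by
      rw [hσx] at e
      have := hρ e
      rwa [Function.update_of_ne hzx] at this))
  have h4 := Ded.mp (.thm (.all_elim _ _ step.1))
    (h2.gen (x := σ x) fun A hA hm => (hFV A hA _ hm).1 hσx)
  rw [step.2] at h4
  exact (h4.gen (x := x) fun A hA hm => (hFV A hA _ hm).2 rfl).bot_of h3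

lemma consistent_iUnion {S : ℕ → Set Closure} (hm : Monotone S)
    (h : ∀ n, Consistent CS (S n)) : Consistent CS (⋃ n, S n) := by
  intro L hLS hL
  obtain ⟨_, ⟨n, rfl⟩, hn⟩ :=
    hm.directed_le.directedOn_range.exists_mem_subset_of_finite_of_subset_sUnion
      (Set.range_nonempty S) hL (by rwa [Set.sUnion_range])
  exact h n L hn hL

/-! ### Countability of the language -/

/-- A code of a justification term. -/
def JTerm.code : JTerm → ℕ
  | jvar i => Nat.pair 0 i
  | const i => Nat.pair 1 i
  | app t s => Nat.pair 2 (Nat.pair t.code s.code)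
  | sum t s => Nat.pair 3 (Nat.pair t.code s.code)
  | bang t => Nat.pair 4 t.code
  | gen x t => Nat.pair 5 (Nat.pair x t.code)

lemma JTerm.code_injective : JTerm.code.Injective := by
  intro t s h
  induction t generalizing s with
  | jvar i => cases s <;> simp_all [code]
  | const i => cases s <;> simp_all [code]
  | app t t' h1 h2 =>
    cases s <;> simp only [code, Nat.pair_eq_pair] at h <;> first | omega | skip
    rw [h1 h.2.1, h2 h.2.2]
  | sum t t' h1 h2 =>
    cases s <;> simp only [code, Nat.pair_eq_pair] at h <;> first | omega | skip
    rw [h1 h.2.1, h2 h.2.2]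
  | bang t ih =>
    cases s <;> simp only [code, Nat.pair_eq_pair] at h <;> first | omega | skip
    rw [ih h.2]
  | gen x t ih =>
    cases s <;> simp only [code, Nat.pair_eq_pair] at h <;> first | omega | skip
    rw [ih h.2.2, h.2.1]

/-- A code of a formula. The arity of a predicate symbol is recorded as the length of its list of
arguments. -/
def Formula.code : Formula → ℕ
  | atom _ i xs => Nat.pair 0 (Nat.pair i (Encodable.encode (List.ofFn xs)))
  | neg Φ => Nat.pair 1 Φ.code
  | conj Φ Ψ => Nat.pair 2 (Nat.pair Φ.code Ψ.code)
  | disj Φ Ψ => Nat.pair 3 (Nat.pair Φ.code Ψ.code)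
  | imp Φ Ψ => Nat.pair 4 (Nat.pair Φ.code Ψ.code)
  | iff Φ Ψ => Nat.pair 5 (Nat.pair Φ.code Ψ.code)
  | all x Φ => Nat.pair 6 (Nat.pair x Φ.code)
  | ex x Φ => Nat.pair 7 (Nat.pair x Φ.code)
  | box X Φ => Nat.pair 8 (Nat.pair (Encodable.encode X) Φ.code)
  | just t X Φ => Nat.pair 9 (Nat.pair t.code (Nat.pair (Encodable.encode X) Φ.code))

lemma Formula.code_injective : Formula.code.Injective := by
  intro Φ Ψ h
  induction Φ generalizing Ψ with
  | atom n i xs =>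
    cases Ψ <;> simp only [code, Nat.pair_eq_pair] at h <;> first | omega | skip
    have := List.ofFn_inj'.1 (Encodable.encode_injective h.2.2)
    rw [Sigma.mk.injEq] at this
    obtain ⟨rfl, h'⟩ := this
    rw [h.2.1, eq_of_heq h']
  | neg Φ ih =>
    cases Ψ <;> simp only [code, Nat.pair_eq_pair] at h <;> first | omega | skip
    rw [ih h.2]
  | conj Φ Φ' h1 h2 | disj Φ Φ' h1 h2 | imp Φ Φ' h1 h2 | iff Φ Φ' h1 h2 =>
    cases Ψ <;> simp only [code, Nat.pair_eq_pair] at h <;> first | omega | skip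
    rw [h1 h.2.1, h2 h.2.2]
  | all x Φ ih | ex x Φ ih =>
    cases Ψ <;> simp only [code, Nat.pair_eq_pair] at h <;> first | omega | skip
    rw [ih h.2.2, h.2.1]
  | box X Φ ih =>
    cases Ψ <;> simp only [code, Nat.pair_eq_pair] at h <;> first | omega | skip
    rw [ih h.2.2, Encodable.encode_injective h.2.1]
  | just t X Φ ih =>
    cases Ψ <;> simp only [code, Nat.pair_eq_pair] at h <;> first | omega | skip
    rw [ih h.2.2.2, Encodable.encode_injective h.2.2.1, JTerm.code_injective h.2.1]

instance : Countable Formula := Formula.code_injective.countable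

instance : Nonempty Formula := ⟨bot⟩

/-! ### Henkin axioms and the Lindenbaum lemma -/

/-- Every consistent set of closures over `D` can be enlarged to a consistent set over `D ∪ C`, with
`C` an infinite set of new parameters, that contains Henkin axioms for all closures over
`D ∪ C`. -/
lemma Consistent.exists_henkin {S : Set Closure} (h : Consistent CS S) {D C : Set ℕ}
    (hS : ∀ d ∈ S, LivesIn D d) (hC : C.Infinite) (hCD : Disjoint C D) :
    ∃ S', S ⊆ S' ∧ Consistent CS S' ∧ (∀ d ∈ S', LivesIn (D ∪ C) d) ∧
      ∀ x Φ ν, LivesIn (D ∪ C) (all x Φ, ν) →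
        ∃ a ∈ C, ∃ μ : Var → ℕ, (∀ y ∈ Φ.FV, y ≠ x → μ y = ν y) ∧
          (imp Φ (all x Φ), Function.update μ x a) ∈ S' := by
  -- Valuations are enumerated up to their values on the finitely many free variables.
  obtain ⟨e, he⟩ := exists_surjective_nat (Var × Formula × (ℕ →₀ ℕ))
  let b : ℕ → ℕ := fun k => (e k).2.1.FV.sup (e k).2.2
  let B : ℕ → ℕ := fun k => ∑ j ∈ Finset.range (k + 1), (b j + 1)
  -- The sums make the sequence `c` of witnesses increasing, with `c k` above all parameters of the
  -- first `k` closures.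
  let c : ℕ → ℕ := fun k => Nat.nth (· ∈ C) (B k)
  have hCi : {n | n ∈ C}.Infinite := hC
  have hcC : ∀ k, c k ∈ C := fun k => Nat.nth_mem_of_infinite hCi _
  have hBmono : StrictMono B := strictMono_nat_of_lt_succ fun k => by
    simp only [B]
    rw [Finset.sum_range_succ _ (k + 1)]
    omega
  have hcmono : StrictMono c := (Nat.nth_strictMono hCi).comp hBmono
  have hbc : ∀ j k, j ≤ k → b j < c k := by
    intro j k hjk
    have h1 : b j + 1 ≤ B k :=
      Finset.single_le_sum (f := fun j => b j + 1) (fun _ _ => Nat.zero_le _)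
        (Finset.mem_range.2 (Nat.lt_succ_of_le hjk))
    have h2 : B k ≤ c k := (Nat.nth_strictMono hCi).le_apply
    omega
  let hk : ℕ → Closure := fun k =>
    (imp (e k).2.1 (all (e k).1 (e k).2.1), Function.update (e k).2.2 (e k).1 (c k))
  have hkval : ∀ k, ∀ y ∈ (hk k).1.FV, (hk k).2 y = c k ∨
      (y ∈ (e k).2.1.FV ∧ y ≠ (e k).1 ∧ (hk k).2 y = (e k).2.2 y) := by
    intro k y hy
    by_cases hyx : y = (e k).1
    · left; simp [hk, hyx]
    · right
      refine ⟨?_, hyx, by simp [hk, hyx]⟩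
      simpa [hk, FV, hyx] using hy
  let T : ℕ → Set Closure := fun n =>
    S ∪ {d | ∃ k < n, LivesIn (D ∪ C) (all (e k).1 (e k).2.1, (e k).2.2) ∧ d = hk k}
  have hT : Monotone T := by
    rintro n m hnm d (hd | ⟨k, hkn, hd⟩)
    · exact .inl hd
    · exact .inr ⟨k, hkn.trans_le hnm, hd⟩
  have hTc : ∀ n, Consistent CS (T n) := by
    intro n
    induction n with
    | zero => simpa [T] using h
    | succ n ih =>
      by_cases hl : LivesIn (D ∪ C) (all (e n).1 (e n).2.1, (e n).2.2)
      · have : T (n + 1) = insert (hk n) (T n) := by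
          ext d
          simp only [T, Set.mem_union, Set.mem_ofPred_eq, Set.mem_insert_iff, Nat.lt_succ_iff_lt_or_eq]
          constructor
          · rintro (hd | ⟨k, hkn | rfl, hd, rfl⟩)
            · exact .inr (.inl hd)
            · exact .inr (.inr ⟨k, hkn, hd, rfl⟩)
            · exact .inl rfl
          · rintro (rfl | hd | ⟨k, hkn, hd⟩)
            · exact .inr ⟨n, .inr rfl, hl, rfl⟩
            · exact .inl hd
            · exact .inr ⟨k, .inl hkn, hd⟩
        rw [this]
        refine ih.insert_henkin ?_ ?_
        · rintro d (hd | ⟨k, hkn, -, rfl⟩) y hy hyc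
          · exact hCD.le_bot ⟨hcC n, hyc ▸ hS d hd y hy⟩
          · rcases hkval k y hy with h' | ⟨hy, -, h'⟩
            · exact (hcmono hkn).ne (h' ▸ hyc)
            · have h1 := hbc k n hkn.le
              have h2 : (e k).2.2 y ≤ b k := Finset.le_sup (f := (e k).2.2) hy
              omega
        · intro y hy _ hyc
          have h1 := hbc n n le_rfl
          have h2 : (e n).2.2 y ≤ b n := Finset.le_sup (f := (e n).2.2) hy
          omega
      · convert ih using 1
        refine (hT n.le_succ).antisymm' ?_
        rintro d (hd | ⟨k, hkn, hd, rfl⟩)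
        · exact .inl hd
        · rcases Nat.lt_succ_iff_lt_or_eq.1 hkn with hkn | rfl
          · exact .inr ⟨k, hkn, hd, rfl⟩
          · exact absurd hd hl
  refine ⟨⋃ n, T n, ?_, consistent_iUnion hT hTc, ?_, ?_⟩
  · exact Set.subset_union_left.trans (Set.subset_iUnion T 0)
  · intro d hd'
    obtain ⟨n, hd | ⟨k, -, hd, rfl⟩⟩ := Set.mem_iUnion.1 hd'
    · exact (hS d hd).mono Set.subset_union_left
    · intro y hy
      rcases hkval k y hy with h' | ⟨hy, hyx, h'⟩
      · rw [h']
        exact .inr (hcC k)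
      · rw [h']
        exact hd y (Finset.mem_erase.2 ⟨hyx, hy⟩)
  · intro x Φ ν hl
    let μ : ℕ →₀ ℕ := Finsupp.onFinset Φ.FV (fun y => if y ∈ Φ.FV then ν y else 0)
      (fun y hy => by by_contra h; simp [h] at hy)
    have hμ : ∀ y ∈ Φ.FV, μ y = ν y := fun y hy => by simp [μ, hy]
    obtain ⟨k, hke⟩ := he (x, Φ, μ)
    refine ⟨c k, hcC k, μ, fun y hy _ => hμ y hy, ?_⟩
    refine Set.mem_iUnion.2 ⟨k + 1, .inr ⟨k, k.lt_succ_self, ?_, ?_⟩⟩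
    · rw [hke]
      intro y hy
      have := hl y hy
      simp only at this ⊢
      rwa [hμ y (Finset.mem_of_mem_erase hy)]
    · simp only [hk, hke]

/-- A world of the canonical model: a maximal consistent set `T` of closures over a coinfinite set
`D` of parameters, in which each false universal formula has a counterexample in `D`. -/
structure World (CS : Set Formula) : Type where
  D : Set ℕ
  T : Set Closure
  coinfinite : Dᶜ.Infinite
  nonempty : D.Nonempty
  lives : ∀ d ∈ T, LivesIn D d
  consistent : Consistent CS T
  complete : ∀ Φ ν, LivesIn D (Φ, ν) → (Φ, ν) ∈ T ∨ (neg Φ, ν) ∈ T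
  henkin : ∀ x Φ ν, (neg (all x Φ), ν) ∈ T → ∃ a ∈ D, (neg Φ, Function.update ν x a) ∈ T

lemma mem_of_complete {D : Set ℕ} {T L : Set Closure} (hT : Consistent CS T)
    (hc : ∀ Φ ν, LivesIn D (Φ, ν) → (Φ, ν) ∈ T ∨ (neg Φ, ν) ∈ T) {Φ : Formula} {ν : Var → ℕ}
    (hl : LivesIn D (Φ, ν)) (hL : L.Finite) (hLT : L ⊆ T)
    (h : ∀ᶠ ρ in fresh, Ded CS (tr ρ '' L) (tr ρ (Φ, ν))) : (Φ, ν) ∈ T := by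
  refine (hc Φ ν hl).resolve_right fun hn => ?_
  refine hT (insert (neg Φ, ν) L) (Set.insert_subset hn hLT) (hL.insert _) ?_
  filter_upwards [h] with ρ hρ
  exact (hρ.mono (Set.image_mono (Set.subset_insert _ _))).bot_of
    (.hyp ⟨_, Set.mem_insert _ _, rfl⟩)

/-- The Lindenbaum lemma. The set of parameters grows, but remains coinfinite. -/
lemma Consistent.exists_world {S : Set Closure} (h : Consistent CS S) {D : Set ℕ}
    (hS : ∀ d ∈ S, LivesIn D d) (hD : Dᶜ.Infinite) :
    ∃ w : World CS, D ⊆ w.D ∧ S ⊆ w.T := by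
  obtain ⟨C, C', hCC, hdis, hcard⟩ := hD.exists_union_disjoint_cardinal_eq_of_infinite
  have hinf : C.Infinite ∧ C'.Infinite := by
    have hiff : C.Infinite ↔ C'.Infinite := by
      rw [← Set.infinite_coe_iff, ← Set.infinite_coe_iff, Cardinal.infinite_iff,
        Cardinal.infinite_iff, hcard]
    rw [← hCC, Set.infinite_union] at hD
    tauto
  have hCD : Disjoint C D := Set.disjoint_left.2 fun a ha => by
    have : a ∈ Dᶜ := hCC ▸ .inl ha
    exact this
  obtain ⟨S', hSS, hS', hlS, hH⟩ := h.exists_henkin hS hinf.1 hCD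
  obtain ⟨T, hST, hTmax⟩ : ∃ T, S' ⊆ T ∧
      Maximal (· ∈ {T | Consistent CS T ∧ ∀ d ∈ T, LivesIn (D ∪ C) d}) T := by
    refine Order.IsOfFiniteCharacter.exists_maximal ?_ ⟨hS', hlS⟩
    refine fun T => ⟨fun hT L hL _ => ⟨fun M hM => hT.1 M (hM.trans hL), fun d hd => hT.2 d (hL hd)⟩,
      fun hT => ⟨fun L hL hLf => (hT L hL hLf).1 L subset_rfl hLf, fun d hd => ?_⟩⟩
    exact (hT {d} (by simpa using hd) (Set.finite_singleton d)).2 d rfl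
  have hmem : ∀ d, LivesIn (D ∪ C) d → Consistent CS (insert d T) → d ∈ T := fun d hd hc =>
    hTmax.le_of_ge (y := insert d T)
      ⟨hc, by rintro _ (rfl | h'); exacts [hd, hTmax.prop.2 _ h']⟩ (Set.subset_insert _ _)
      (Set.mem_insert _ _)
  have hcomp : ∀ Φ ν, LivesIn (D ∪ C) (Φ, ν) → (Φ, ν) ∈ T ∨ (neg Φ, ν) ∈ T := fun Φ ν hl =>
    (hTmax.prop.1.or_neg Φ ν).imp (hmem _ hl) (hmem (neg Φ, ν) hl)
  refine ⟨⟨D ∪ C, T, ?_, ?_, hTmax.prop.2, hTmax.prop.1, hcomp, ?_⟩, Set.subset_union_left,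
    hSS.trans hST⟩
  · refine hinf.2.mono fun a ha => ?_
    have : a ∈ Dᶜ := hCC ▸ .inr ha
    rintro (h' | h')
    exacts [this h', Set.disjoint_left.1 hdis h' ha]
  · exact hinf.1.nonempty.mono Set.subset_union_right
  · intro x Φ ν hn
    obtain ⟨a, ha, μ, hμ, hm⟩ := hH x Φ ν (hTmax.prop.2 (neg (all x Φ), ν) hn)
    refine ⟨a, .inr ha, ?_⟩
    refine mem_of_complete (L := {(neg (all x Φ), ν), (imp Φ (all x Φ), Function.update μ x a)})
      hTmax.prop.1 hcomp ?_ (by simp) ?_ (.of_forall fun ρ => ?_)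
    · intro y hy
      by_cases hyx : y = x
      · subst hyx; simpa using .inr ha
      · simp only [Function.update_of_ne hyx]
        exact hTmax.prop.2 _ hn y (Finset.mem_erase.2 ⟨hyx, hy⟩)
    · rintro d (rfl | rfl)
      exacts [hn, hST hm]
    · have e1 : tr ρ (all x Φ, ν) = tr ρ (all x Φ, Function.update μ x a) :=
        tr_congr (fun y hy => by
          obtain ⟨hyx, hy⟩ := Finset.mem_erase.1 hy
          rw [Function.update_of_ne hyx, hμ y hy hyx]) ρ
      have e2 : tr ρ (Φ, Function.update ν x a) = tr ρ (Φ, Function.update μ x a) :=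
        tr_congr (fun y hy => by
          by_cases hyx : y = x
          · simp [hyx]
          · rw [Function.update_of_ne hyx, Function.update_of_ne hyx, hμ y hy hyx]) ρ
      have h1 : Ded CS (tr ρ '' {(neg (all x Φ), ν), (imp Φ (all x Φ), Function.update μ x a)})
          (neg (tr ρ (all x Φ, ν))) := .hyp ⟨_, .inl rfl, rfl⟩
      have h2 : Ded CS (tr ρ '' {(neg (all x Φ), ν), (imp Φ (all x Φ), Function.update μ x a)})
          (imp (tr ρ (Φ, Function.update μ x a)) (tr ρ (all x Φ, Function.update μ x a))) :=
        .hyp ⟨_, .inr rfl, rfl⟩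
      change Ded CS _ (neg (tr ρ (Φ, Function.update ν x a)))
      rw [e1] at h1
      rw [e2]
      exact h1.taut2 h2 fun v hv => by simp only [hv.neg, hv.imp]; tauto

/-! ### Worlds and accessibility -/

lemma Prov.eventually_tr {Φ : Formula} (h : Prov CS Φ) (ν : Var → ℕ) :
    ∀ᶠ ρ in fresh, Prov CS (tr ρ (Φ, ν)) := by
  filter_upwards [eventually_avoid Φ.vars] with ρ hρ
  exact h.subst_fresh fun z => hρ (ν z)

lemma Ded.derivable {Γ : Set Formula} (hΓ : ∀ Ψ ∈ Γ, Ψ.Closed) {A : Formula}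
    (h : Ded CS Γ A) : Derivable CS Γ A := by
  have hprov : ∀ {A}, Prov CS A → Derivable CS Γ A := by
    intro A hA
    induction hA with
    | hyp A hA => exact absurd hA (Set.notMem_empty _)
    | ax A hA => exact .ax A hA
    | cs A hA => exact .cs A hA
    | mp A B _ _ h1 h2 => exact .mp A B h1 h2
    | gen x A _ _ ih => exact .gen x A (fun Ψ hΨ => by simp [show Ψ.FV = ∅ from hΓ Ψ hΨ]) ih
    | nec A hA => exact .nec A hA
  induction h with
  | hyp h => exact .hyp _ h
  | thm h => exact hprov h
  | mp _ _ h1 h2 => exact .mp _ _ h2 h1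

/-- Closed formulas are not affected by the translations, so an inconsistency of the closures of
`Γ ∪ {¬Φ}` is a derivation of `Φ` from `Γ`. -/
lemma consistent_of_not_derivable {Γ : Set Formula} (hΓ : ∀ Ψ ∈ Γ, Ψ.Closed) {Φ : Formula}
    (hΦ : Φ.Closed) (h : ¬ Derivable CS Γ Φ) (ν : Var → ℕ) :
    Consistent CS (insert (neg Φ, ν) ((fun Ψ => (Ψ, ν)) '' Γ)) := by
  by_contra hc
  obtain ⟨L, hL, -, hd⟩ := exists_of_not_consistent_insert hc
  obtain ⟨ρ, hd⟩ := hd.exists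
  have hsub : tr ρ '' L ⊆ Γ := by
    rintro _ ⟨d, hdL, rfl⟩
    obtain ⟨Ψ, hΨ, rfl⟩ := hL hdL
    rwa [tr, subst_of_closed (hΓ Ψ hΨ)]
  rw [tr, subst_of_closed (Φ := neg Φ) hΦ] at hd
  replace hd : Ded CS Γ Φ := (hd.mono hsub).taut1 fun v hv => by simp only [hv.neg]; tauto
  exact h (hd.derivable hΓ)

lemma Consistent.mono {S S' : Set Closure} (h : Consistent CS S') (hS : S ⊆ S') :
    Consistent CS S := fun L hL => h L (hL.trans hS)

namespace World

variable {w u : World CS} {A B C Φ Ψ : Formula} {ν μ : Var → ℕ}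

/-- Worlds are closed under parametric consequence. -/
lemma mem_of_ded {L : Set Closure} (hl : LivesIn w.D (Φ, ν)) (hL : L.Finite) (hLT : L ⊆ w.T)
    (h : ∀ᶠ ρ in fresh, Ded CS (tr ρ '' L) (tr ρ (Φ, ν))) : (Φ, ν) ∈ w.T :=
  mem_of_complete w.consistent w.complete hl hL hLT h

lemma mem_of_thm (h : Prov CS A) (hl : LivesIn w.D (A, ν)) : (A, ν) ∈ w.T := by
  refine mem_of_ded hl Set.finite_empty (Set.empty_subset _) ?_
  filter_upwards [h.eventually_tr ν] with ρ hρ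
  exact .thm hρ

lemma mem_of_prov (h : Prov CS (imp A B)) (hA : (A, ν) ∈ w.T) (hl : LivesIn w.D (B, ν)) :
    (B, ν) ∈ w.T := by
  refine mem_of_ded (L := {(A, ν)}) hl (Set.finite_singleton _) (by simpa using hA) ?_
  filter_upwards [h.eventually_tr ν] with ρ hρ
  exact .mp (.thm hρ) (.hyp ⟨_, rfl, rfl⟩)

lemma mem_of_prov₂ (h : Prov CS (imp A (imp B C))) (hA : (A, ν) ∈ w.T) (hB : (B, ν) ∈ w.T)
    (hl : LivesIn w.D (C, ν)) : (C, ν) ∈ w.T := by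
  refine mem_of_ded (L := {(A, ν), (B, ν)}) hl (by simp) ?_ ?_
  · rintro d (rfl | rfl)
    exacts [hA, hB]
  filter_upwards [h.eventually_tr ν] with ρ hρ
  exact .mp (.mp (.thm hρ) (.hyp ⟨_, .inl rfl, rfl⟩)) (.hyp ⟨_, .inr rfl, rfl⟩)

/-- Membership of a closure in a world depends only on its translations. -/
lemma mem_of_tr_eq (hA : (A, μ) ∈ w.T) (h : ∀ ρ, tr ρ (A, μ) = tr ρ (B, ν))
    (hl : LivesIn w.D (B, ν)) : (B, ν) ∈ w.T := by
  refine mem_of_ded (L := {(A, μ)}) hl (Set.finite_singleton _) (by simpa using hA)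
    (.of_forall fun ρ => ?_)
  rw [← h ρ]
  exact .hyp ⟨_, rfl, rfl⟩

lemma mem_congr (h : ∀ x ∈ A.FV, μ x = ν x) (hA : (A, μ) ∈ w.T) : (A, ν) ∈ w.T := by
  refine mem_of_tr_eq hA (tr_congr h) fun x hx => ?_
  have := w.lives _ hA x hx
  simpa only [← h x hx] using this

lemma mem_neg_iff (hl : LivesIn w.D (Φ, ν)) : (neg Φ, ν) ∈ w.T ↔ (Φ, ν) ∉ w.T := by
  refine ⟨fun hn h => ?_, (w.complete Φ ν hl).resolve_left⟩
  refine w.consistent {(Φ, ν), (neg Φ, ν)} ?_ (by simp) (.of_forall fun ρ => ?_)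
  · rintro d (rfl | rfl)
    exacts [h, hn]
  · exact Ded.bot_of (A := tr ρ (Φ, ν)) (.hyp ⟨_, .inl rfl, rfl⟩) (.hyp ⟨_, .inr rfl, rfl⟩)

lemma mem_imp_iff (hΦ : LivesIn w.D (Φ, ν)) (hΨ : LivesIn w.D (Ψ, ν)) :
    (imp Φ Ψ, ν) ∈ w.T ↔ ((Φ, ν) ∈ w.T → (Ψ, ν) ∈ w.T) := by
  have hl : LivesIn w.D (imp Φ Ψ, ν) := fun x hx =>
    (Finset.mem_union.1 hx).elim (hΦ x) (hΨ x)
  refine ⟨fun h h' => mem_of_prov₂ (.imp_self _) h h' hΨ, fun h => ?_⟩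
  by_cases h' : (Φ, ν) ∈ w.T
  · exact mem_of_prov (A := Ψ) (.taut fun v hv => by simp only [hv.imp]; tauto) (h h') hl
  · rw [← mem_neg_iff hΦ] at h'
    exact mem_of_prov (.taut fun v hv => by simp only [hv.imp, hv.neg]; tauto) h' hl

/-- Provably equivalent formulas belong to the same worlds. -/
lemma mem_iff_of_prov (h : Prov CS (iff A B)) (hA : LivesIn w.D (A, ν))
    (hB : LivesIn w.D (B, ν)) : (A, ν) ∈ w.T ↔ (B, ν) ∈ w.T :=
  ⟨fun h' => mem_of_prov (Ded.taut1 (H := ∅) (.thm h)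
      fun v hv => by simp only [hv.imp, hv.iff]; tauto).prov h' hB,
    fun h' => mem_of_prov (Ded.taut1 (H := ∅) (.thm h)
      fun v hv => by simp only [hv.imp, hv.iff]; tauto).prov h' hA⟩

lemma livesIn_left {op : Formula} (h : op.FV = A.FV ∪ B.FV) (hl : LivesIn w.D (op, ν)) :
    LivesIn w.D (A, ν) :=
  fun x hx => hl x (by simpa [h] using .inl hx)

lemma livesIn_right {op : Formula} (h : op.FV = A.FV ∪ B.FV) (hl : LivesIn w.D (op, ν)) :
    LivesIn w.D (B, ν) :=
  fun x hx => hl x (by simpa [h] using .inr hx)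

lemma mem_conj_iff (hl : LivesIn w.D (conj Φ Ψ, ν)) :
    (conj Φ Ψ, ν) ∈ w.T ↔ (Φ, ν) ∈ w.T ∧ (Ψ, ν) ∈ w.T := by
  have hΦ := livesIn_left rfl hl
  have hΨ := livesIn_right rfl hl
  have e : Prov CS (iff (conj Φ Ψ) (neg (imp Φ (neg Ψ)))) :=
    .taut fun v hv => by simp only [hv.iff, hv.conj, hv.neg, hv.imp]; tauto
  rw [mem_iff_of_prov e hl hl, mem_neg_iff (Φ := imp Φ (neg Ψ)) hl,
    mem_imp_iff (Ψ := neg Ψ) hΦ hΨ,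
    mem_neg_iff hΨ]
  tauto

lemma mem_disj_iff (hl : LivesIn w.D (disj Φ Ψ, ν)) :
    (disj Φ Ψ, ν) ∈ w.T ↔ (Φ, ν) ∈ w.T ∨ (Ψ, ν) ∈ w.T := by
  have hΦ := livesIn_left rfl hl
  have hΨ := livesIn_right rfl hl
  have e : Prov CS (iff (disj Φ Ψ) (imp (neg Φ) Ψ)) :=
    .taut fun v hv => by simp only [hv.iff, hv.disj, hv.neg, hv.imp]; tauto
  rw [mem_iff_of_prov e hl hl, mem_imp_iff (Φ := neg Φ) hΦ hΨ, mem_neg_iff hΦ]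
  tauto

lemma mem_biimp_iff (hl : LivesIn w.D (iff Φ Ψ, ν)) :
    (iff Φ Ψ, ν) ∈ w.T ↔ ((Φ, ν) ∈ w.T ↔ (Ψ, ν) ∈ w.T) := by
  have hΦ := livesIn_left rfl hl
  have hΨ := livesIn_right rfl hl
  have hl' : LivesIn w.D (conj (imp Φ Ψ) (imp Ψ Φ), ν) := fun x hx => hl x (by
    simp only [FV, Finset.mem_union] at hx ⊢
    tauto)
  have e : Prov CS (iff (iff Φ Ψ) (conj (imp Φ Ψ) (imp Ψ Φ))) :=
    .taut fun v hv => by simp only [hv.iff, hv.conj, hv.imp]; tauto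
  rw [mem_iff_of_prov e hl hl', mem_conj_iff hl', mem_imp_iff hΦ hΨ, mem_imp_iff hΨ hΦ]
  tauto

lemma livesIn_update {x : Var} {a : ℕ} (hl : ∀ y ∈ Φ.FV.erase x, ν y ∈ w.D) (ha : a ∈ w.D) :
    LivesIn w.D (Φ, Function.update ν x a) := by
  intro y hy
  by_cases hyx : y = x
  · subst hyx; simpa using ha
  · simpa [hyx] using hl y (Finset.mem_erase.2 ⟨hyx, hy⟩)

lemma mem_all_iff {x : Var} (hl : LivesIn w.D (all x Φ, ν)) :
    (all x Φ, ν) ∈ w.T ↔ ∀ a ∈ w.D, (Φ, Function.update ν x a) ∈ w.T := by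
  refine ⟨fun h a ha => ?_, fun h => ?_⟩
  · refine mem_of_prov (.all_elim_self x Φ) (mem_congr (fun y hy => ?_) h) (livesIn_update hl ha)
    rw [Function.update_of_ne (Finset.mem_erase.1 hy).1]
  · by_contra hn
    obtain ⟨a, ha, hna⟩ := w.henkin x Φ ν ((mem_neg_iff hl).2 hn)
    exact (mem_neg_iff (livesIn_update hl ha)).1 hna (h a ha)

lemma mem_ex_iff {x : Var} (hl : LivesIn w.D (ex x Φ, ν)) :
    (ex x Φ, ν) ∈ w.T ↔ ∃ a ∈ w.D, (Φ, Function.update ν x a) ∈ w.T := by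
  rw [mem_iff_of_prov (.ex_iff x Φ) hl hl, mem_neg_iff (Φ := all x (neg Φ)) hl,
    mem_all_iff (Φ := neg Φ) hl]
  push Not
  exact exists_congr fun a => and_congr_right fun ha => by
    rw [mem_neg_iff (livesIn_update hl ha), not_not]

lemma mem_just_iff {t : JTerm} {X Y : Finset Var} (hXY : X ⊆ Y)
    (hY : ∀ y ∈ Y, y ∉ X → y ∉ Φ.FV) (hl : LivesIn w.D (just t Y Φ, ν)) :
    (just t X Φ, ν) ∈ w.T ↔ (just t Y Φ, ν) ∈ w.T :=
  ⟨fun h => mem_of_prov (.just_mono hXY t Φ) h hl,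
    fun h => mem_of_prov (.just_drop hXY hY) h fun x hx => hl x (hXY hx)⟩

/-- The accessibility relation of the canonical model: if `□_X Φ` belongs to `w`, then `Φ` belongs to
`u` for all values in `u` of the variables outside `X`. -/
def rel (w u : World CS) : Prop :=
  w.D ⊆ u.D ∧ ∀ X Φ ν μ, (box X Φ, ν) ∈ w.T → (∀ x ∈ X, μ x = ν x) → LivesIn u.D (Φ, μ) →
    (Φ, μ) ∈ u.T

lemma rel_of_boxes (hD : w.D ⊆ u.D) (h : ∀ X Φ ν, (box X Φ, ν) ∈ w.T → (box X Φ, ν) ∈ u.T) :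
    rel w u :=
  ⟨hD, fun X Φ ν _ hb hμ hl => mem_of_prov (.ofAxiom (.boxRefl X Φ))
    (mem_congr (fun x hx => (hμ x hx).symm) (h X Φ ν hb)) hl⟩

lemma rel_refl (w : World CS) : rel w w := rel_of_boxes subset_rfl fun _ _ _ h => h

lemma rel.box_mem {X : Finset Var} (h : rel w u) (hb : (box X Φ, ν) ∈ w.T) :
    (box X Φ, ν) ∈ u.T := by
  have hl : LivesIn w.D (box X Φ, ν) := w.lives _ hb
  exact h.2 X _ ν ν (mem_of_prov (.ofAxiom (.boxTrans X Φ)) hb hl) (fun _ _ => rfl)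
    (hl.mono h.1)

lemma rel_trans {v : World CS} (h : rel w u) (h' : rel u v) : rel w v :=
  rel_of_boxes (h.1.trans h'.1) fun _ _ _ hb => h'.box_mem (h.box_mem hb)

lemma rel.just_mem {t : JTerm} {X : Finset Var} (h : rel w u) (hb : (just t X Φ, ν) ∈ w.T) :
    (just t X Φ, ν) ∈ u.T := by
  have hl : LivesIn w.D (just t X Φ, ν) := w.lives _ hb
  have h1 : Prov CS (imp (just t X Φ) (box X (just t X Φ))) :=
    Prov.trans (.ofAxiom (.justBang t X Φ)) (.ofAxiom (.justBox _ _ _))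
  exact h.2 X _ ν ν (mem_of_prov h1 hb hl) (fun _ _ => rfl) (hl.mono h.1)

/-- If `□_X Φ` fails at `w`, then the boxed closures of `w` are consistent with the negation of `Φ` in
which the variables outside `X` are interpreted by distinct new parameters. -/
lemma consistent_boxes (hCS : IsConstantSpecification CS) {X : Finset Var}
    (hl : LivesIn w.D (box X Φ, ν)) (hn : (box X Φ, ν) ∉ w.T)
    (hμν : ∀ x ∈ X, μ x = ν x) (hμD : ∀ y ∈ Φ.FV \ X, μ y ∉ w.D)
    (hμ : Set.InjOn μ ↑(Φ.FV \ X)) :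
    Consistent CS (insert (neg Φ, μ) {d ∈ w.T | ∃ Y Ψ, d.1 = box Y Ψ}) := by
  by_contra hc
  obtain ⟨L, hLS, hL, hd⟩ := exists_of_not_consistent_insert hc
  refine hn (mem_of_ded hl hL (fun d hd => (hLS hd).1) ?_)
  filter_upwards [hd, eventually_injective, eventually_avoid Φ.vars] with ρ hd hρ hF
  set H := tr ρ '' L with hH
  have h1 : Ded CS H (subst (ρ ∘ μ) Φ) := hd.taut1 fun v hv => by
    simp only [tr, subst, hv.neg]
    tauto
  let Z₀ : Finset Var := X.image (ρ ∘ ν)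
  let Z : Finset Var := Z₀ ∪ hL.toFinset.biUnion fun d => (tr ρ d).FV
  have h2 : Ded CS H (box Z (subst (ρ ∘ μ) Φ)) := by
    refine h1.box hCS ?_
    rintro _ ⟨d, hdL, rfl⟩
    obtain ⟨Y, Ψ, hdY⟩ := (hLS hdL).2
    obtain ⟨_, κ⟩ := d
    obtain rfl : _ = box Y Ψ := hdY
    have hYZ : Y.image (ρ ∘ κ) ⊆ Z := fun z hz =>
      Finset.mem_union_right _ (Finset.mem_biUnion.2 ⟨_, hL.mem_toFinset.2 hdL, hz⟩)
    exact .mp (.thm (Prov.trans (.ofAxiom (.boxTrans _ _)) (.box_mono hYZ _)))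
      (.hyp ⟨_, hdL, rfl⟩)
  have hZ₀ : ∀ x ∈ Φ.FV \ X, ρ (μ x) ∉ Z₀ := by
    intro x hx hm
    obtain ⟨q, hq, e⟩ := Finset.mem_image.1 hm
    exact hμD x hx (hρ e ▸ hl q hq)
  have h3 : Ded CS H (box Z₀ (subst (ρ ∘ μ) Φ)) := by
    refine .mp (.thm (.box_drop Finset.subset_union_left ?_)) h2
    intro y hy hy0 hyF
    rcases Finset.mem_union.1 hy with hy | hy
    · exact hy0 hy
    · obtain ⟨d, hdL, hyd⟩ := Finset.mem_biUnion.1 hy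
      obtain ⟨p, hp, hpy⟩ := exists_of_mem_FV_tr hyd
      have hpD := w.lives d (hLS (hL.mem_toFinset.1 hdL)).1 p hp
      obtain ⟨q, hq, hqy⟩ := Finset.mem_image.1 (FV_subst_subset _ _ hyF)
      by_cases hqX : q ∈ X
      · refine hy0 (Finset.mem_image.2 ⟨q, hqX, ?_⟩)
        rw [← hqy, Function.comp, Function.comp, hμν q hqX]
      · refine hμD q (Finset.mem_sdiff.2 ⟨hq, hqX⟩) ?_
        rwa [hρ (hqy.trans hpy.symm)]
  -- The variables standing for the new parameters are bound by `□` and can be renamed back.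
  refine subst_induction (σ := ρ ∘ μ) (τ := restrictSubst X (ρ ∘ ν)) (S := Φ.FV \ X)
    (fun Ψ => Ded CS H (box Z₀ Ψ)) (fun z _ => .inr (hF _)) ?_ ?_ ?_ ?_ h3
  · intro z _
    by_cases hz : z ∈ X
    · right
      simpa [restrictSubst, hz] using hF _
    · left
      simp [restrictSubst, hz]
  · intro z hz hzS
    have hzX : z ∈ X := by
      by_contra hzX
      exact hzS (Finset.mem_sdiff.2 ⟨hz, hzX⟩)
    simp [restrictSubst, hzX, hμν z hzX]
  · intro x hx z hz hzx
    constructor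
    · intro e
      replace e := hρ e
      by_cases hzX : z ∈ X
      · exact hμD x hx (e ▸ hμν z hzX ▸ hl z hzX)
      · exact hzx (hμ (Finset.mem_sdiff.2 ⟨hz, hzX⟩) hx e)
    · intro e
      by_cases hzX : z ∈ X
      · simp only [restrictSubst, hzX, if_true] at e
        exact hμD x hx (hρ e ▸ hl z hzX)
      · simp only [restrictSubst, hzX, if_false] at e
        exact hF (μ x) (by
          have := FV_subset_vars _ hz
          rwa [e] at this)
  · intro Ψ x hx ha h
    exact .mp (.thm (.box_subst_single hCS (hZ₀ x hx) ha)) h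

/-- A successor in which `Φ` fails for some values of the variables bound by `□_X`. -/
lemma exists_rel_of_not_mem_box (hCS : IsConstantSpecification CS) {X : Finset Var}
    (hl : LivesIn w.D (box X Φ, ν)) (hn : (box X Φ, ν) ∉ w.T) :
    ∃ u, rel w u ∧ ∃ μ : Var → ℕ, (∀ y, y ∉ Φ.FV \ X → μ y = ν y) ∧
      (∀ y ∈ Φ.FV \ X, μ y ∈ u.D) ∧ (Φ, μ) ∉ u.T := by
  let e := w.coinfinite.natEmbedding
  let μ : Var → ℕ := fun y => if y ∈ Φ.FV \ X then e y else ν y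
  have hμe : ∀ y ∈ Φ.FV \ X, μ y = e y := fun y hy => if_pos hy
  have hμν : ∀ y, y ∉ Φ.FV \ X → μ y = ν y := fun y hy => if_neg hy
  have hμX : ∀ x ∈ X, μ x = ν x := fun x hx => hμν x fun h => (Finset.mem_sdiff.1 h).2 hx
  have hc := consistent_boxes hCS hl hn hμX (fun y hy => by rw [hμe y hy]; exact (e y).2)
    (fun y hy z hz h => e.injective (Subtype.ext (by rw [← hμe y hy, ← hμe z hz, h])))
  obtain ⟨u, hDu, hSu⟩ := hc.exists_world (D := w.D ∪ ↑((Φ.FV \ X).image μ)) (by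
    rintro d (rfl | hd)
    · intro x hx
      by_cases hxX : x ∈ X
      · left
        change μ x ∈ w.D
        rw [hμX x hxX]
        exact hl x hxX
      · right
        exact Finset.mem_coe.2 (Finset.mem_image_of_mem _ (Finset.mem_sdiff.2 ⟨hx, hxX⟩))
    · exact (w.lives d hd.1).mono Set.subset_union_left) (by
    rw [Set.compl_union]
    exact w.coinfinite.sdiff (Finset.finite_toSet _))
  have hneg : (neg Φ, μ) ∈ u.T := hSu (Set.mem_insert _ _)
  have hlu : LivesIn u.D (Φ, μ) := u.lives (neg Φ, μ) hneg
  refine ⟨u, rel_of_boxes (Set.subset_union_left.trans hDu) ?_, μ, hμν, ?_, ?_⟩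
  · exact fun Y Ψ κ h => hSu (.inr ⟨h, Y, Ψ, rfl⟩)
  · exact fun y hy => hlu y (Finset.mem_sdiff.1 hy).1
  · exact (mem_neg_iff hlu).1 hneg

end World

/-! ### The canonical model -/

/-- A total valuation extending a finite one; the values outside the domain are immaterial. -/
def FinVal.toVal (f : FinVal ℕ) : Var → ℕ := fun x => (f.toFun x).getD 0

/-- The variables in `S` at which `f` is defined. -/
def FinVal.domIn (f : FinVal ℕ) (S : Finset Var) : Finset Var :=
  S.filter fun x => f.toFun x ≠ none

lemma FinVal.mem_domIn {f : FinVal ℕ} {S : Finset Var} {x : Var} :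
    x ∈ f.domIn S ↔ x ∈ S ∧ x ∈ f.Dom := Finset.mem_filter

lemma FinVal.toFun_of_mem {f : FinVal ℕ} {x : Var} (h : x ∈ f.Dom) :
    f.toFun x = some (f.toVal x) := by
  obtain ⟨a, ha⟩ := Option.ne_none_iff_exists'.1 h
  simp [toVal, ha]

lemma FinVal.Le.mem_dom {f g : FinVal ℕ} (h : f.Le g) {x : Var} (hx : x ∈ f.Dom) :
    x ∈ g.Dom := by
  change g.toFun x ≠ none
  rw [h x _ (toFun_of_mem hx)]
  simp

lemma FinVal.Le.toVal {f g : FinVal ℕ} (h : f.Le g) {x : Var} (hx : x ∈ f.Dom) :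
    f.toVal x = g.toVal x :=
  Option.some_injective _ ((h x _ (toFun_of_mem hx)).symm.trans (toFun_of_mem (h.mem_dom hx)))

lemma livesIn_just {D : Set ℕ} {f : FinVal ℕ} (hf : f.ImIn D) {X : Finset Var}
    (hX : ∀ x ∈ X, x ∈ f.Dom) (t : JTerm) (Φ : Formula) : LivesIn D (just t X Φ, f.toVal) :=
  fun x hx => hf x _ (FinVal.toFun_of_mem (hX x hx))

/-- The canonical evidence function: `t` is evidence at `w` for `Φ` with the free variables in the
domain of `f` interpreted by `f`, the other ones being bound. -/
def canonicalE (CS : Set Formula) (t : JTerm) (Φ : Formula) (f : FinVal ℕ) : Set (World CS) :=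
  {w | f.ImIn w.D ∧ (just t (f.domIn Φ.FV) Φ, f.toVal) ∈ w.T}

variable {w u : World CS} {t s : JTerm} {Φ Ψ : Formula} {f g : FinVal ℕ}

/-- The index in the definition of the canonical evidence function can be any set between
`Dom f ∩ FV Φ` and `Dom f`. -/
lemma mem_canonicalE_iff {X : Finset Var} (hf : f.ImIn w.D) (hX : ∀ x ∈ X, x ∈ f.Dom)
    (hΦ : f.domIn Φ.FV ⊆ X) :
    w ∈ canonicalE CS t Φ f ↔ (just t X Φ, f.toVal) ∈ w.T := by
  change _ ∧ _ ↔ _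
  rw [and_iff_right hf]
  exact World.mem_just_iff hΦ (fun y hy hn hyF => hn (FinVal.mem_domIn.2 ⟨hyF, hX y hy⟩))
    (livesIn_just hf hX t Φ)

lemma canonicalE_extension (hfg : f.Le g) (hg : g.ImIn w.D) (h : w ∈ canonicalE CS t Φ f) :
    w ∈ canonicalE CS t Φ g := by
  have hX : ∀ x ∈ f.domIn Φ.FV, x ∈ f.Dom := fun x hx => (FinVal.mem_domIn.1 hx).2
  refine ⟨hg, World.mem_of_prov (.just_mono (X := f.domIn Φ.FV) (fun x hx => ?_) t Φ)
    (World.mem_congr (fun x hx => hfg.toVal (hX x hx)) h.2)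
    (livesIn_just hg (fun x hx => (FinVal.mem_domIn.1 hx).2) t Φ)⟩
  rw [FinVal.mem_domIn] at hx ⊢
  exact ⟨hx.1, hfg.mem_dom hx.2⟩

lemma canonicalE_subst {σ : Var → Var} (ha : Φ.Admissible σ)
    (hσ : ∀ x ∈ Φ.FV, σ x ≠ x → σ x ∈ f.Dom) :
    canonicalE CS t (Φ.subst σ) (f.restrict (Φ.subst σ).FV) =
      canonicalE CS t Φ (f.comp σ Φ.FV) := by
  set f₁ := f.restrict (Φ.subst σ).FV with hf₁
  set f₂ := f.comp σ Φ.FV with hf₂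
  have hFV := FV_subst ha
  have h₁ : ∀ x ∈ Φ.FV, f₁.toFun (σ x) = f.toFun (σ x) := fun x hx =>
    if_pos (hFV ▸ Finset.mem_image_of_mem σ hx)
  have h₂ : ∀ x ∈ Φ.FV, f₂.toFun x = f.toFun (σ x) := fun x hx => if_pos hx
  have hdom : ∀ x ∈ Φ.FV, σ x ∈ f₁.domIn (Φ.subst σ).FV ↔ x ∈ f₂.domIn Φ.FV := by
    intro x hx
    rw [FinVal.mem_domIn, FinVal.mem_domIn, FinVal.Dom, FinVal.Dom, Set.mem_ofPred_eq,
      Set.mem_ofPred_eq, h₁ x hx, h₂ x hx]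
    exact and_congr_left fun _ => iff_of_true (hFV ▸ Finset.mem_image_of_mem σ hx) hx
  have hdom' : f₁.domIn (Φ.subst σ).FV = (f₂.domIn Φ.FV).image σ := by
    ext y
    constructor
    · intro hy
      obtain ⟨x, hx, rfl⟩ := Finset.mem_image.1 (hFV ▸ (FinVal.mem_domIn.1 hy).1)
      exact Finset.mem_image_of_mem _ ((hdom x hx).1 hy)
    · intro hy
      obtain ⟨x, hx, rfl⟩ := Finset.mem_image.1 hy
      exact (hdom x (FinVal.mem_domIn.1 hx).1).2 hx
  have hval : ∀ x ∈ Φ.FV, f₁.toVal (σ x) = f₂.toVal x := fun x hx => by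
    simp only [FinVal.toVal, h₁ x hx, h₂ x hx]
  -- Both sides speak about closures with literally the same translations.
  have htr : ∀ ρ, tr ρ (just t (f₁.domIn (Φ.subst σ).FV) (Φ.subst σ), f₁.toVal) =
      tr ρ (just t (f₂.domIn Φ.FV) Φ, f₂.toVal) := by
    intro ρ
    have e1 : (f₁.domIn (Φ.subst σ).FV).image (ρ ∘ f₁.toVal) =
        (f₂.domIn Φ.FV).image (ρ ∘ f₂.toVal) := by
      rw [hdom', Finset.image_image]
      refine Finset.image_congr fun x hx => ?_
      simp only [Function.comp, hval x (FinVal.mem_domIn.1 hx).1]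
    simp only [tr, subst, e1, subst_comp ha]
    congr 1
    refine subst_congr fun x hx => ?_
    by_cases hx' : x ∈ f₂.domIn Φ.FV
    · simp only [Function.comp, restrictSubst, (hdom x hx).2 hx', hx', if_true, hval x hx]
    · have h' : σ x ∉ f₁.domIn (Φ.subst σ).FV := fun h => hx' ((hdom x hx).1 h)
      simp only [Function.comp, restrictSubst, h', hx', if_false]
      by_contra hne
      refine hx' (FinVal.mem_domIn.2 ⟨hx, ?_⟩)
      change f₂.toFun x ≠ none
      rw [h₂ x hx]
      exact hσ x hx hne
  have him : ∀ D : Set ℕ, f₁.ImIn D ↔ f₂.ImIn D := by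
    intro D
    constructor
    · intro h x d hx
      by_cases hxF : x ∈ Φ.FV
      · exact h (σ x) d (by rw [h₁ x hxF, ← h₂ x hxF, hx])
      · simp [hf₂, FinVal.comp, hxF] at hx
    · intro h y d hy
      by_cases hyF : y ∈ (Φ.subst σ).FV
      · obtain ⟨x, hx, rfl⟩ := Finset.mem_image.1 (hFV ▸ hyF)
        exact h x d (by rw [h₂ x hx, ← h₁ x hx, hy])
      · simp [hf₁, FinVal.restrict, hyF] at hy
  ext w
  have hf₁d : ∀ x ∈ f₁.domIn (Φ.subst σ).FV, x ∈ f₁.Dom := fun x hx => (FinVal.mem_domIn.1 hx).2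
  have hf₂d : ∀ x ∈ f₂.domIn Φ.FV, x ∈ f₂.Dom := fun x hx => (FinVal.mem_domIn.1 hx).2
  exact ⟨fun h => ⟨(him _).1 h.1, World.mem_of_tr_eq h.2 htr
      (livesIn_just ((him _).1 h.1) hf₂d t Φ)⟩,
    fun h => ⟨(him _).2 h.1, World.mem_of_tr_eq h.2 (fun ρ => (htr ρ).symm)
      (livesIn_just ((him _).2 h.1) hf₁d t _)⟩⟩

/-- The canonical model. -/
def canonicalModel (CS : Set Formula) (h0 : Consistent CS ∅) : FittingModel where
  W := World CS
  U := ℕ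
  R := World.rel
  D := World.D
  I n i w := {a | ∃ xs ν, (atom n i xs, ν) ∈ w.T ∧ a = fun k => ν (xs k)}
  E := canonicalE CS
  nonempty_W :=
    let ⟨w, _⟩ := h0.exists_world (D := ∅) (by simp) (by simpa using Set.infinite_univ)
    ⟨w⟩
  refl_R := World.rel_refl
  trans_R _ _ _ := World.rel_trans
  nonempty_D := World.nonempty
  union_D a :=
    let ⟨w, hw, _⟩ := h0.exists_world (D := {a}) (by simp)
      (Set.finite_singleton a).infinite_compl
    ⟨w, hw rfl⟩
  mono_D _ _ h := h.1
  I_subset := by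
    rintro n i w _ ⟨xs, ν, h, rfl⟩ k
    exact w.lives _ h _ (Finset.mem_image_of_mem _ (Finset.mem_univ k))
  E_adequacy _ _ _ _ h := h.1
  E_subst _ _ _ _ ha hσ := canonicalE_subst ha hσ
  E_closure _ _ _ _ _ hR h := ⟨fun x d hx => hR.1 (h.1 x d hx), hR.just_mem h.2⟩
  E_extension _ _ _ _ _ hfg hg h := canonicalE_extension hfg hg h
  E_restriction := by
    intro t Φ f w h
    have hr : ∀ x ∈ Φ.FV, (f.restrict Φ.FV).toFun x = f.toFun x := fun x hx => if_pos hx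
    have hd : (f.restrict Φ.FV).domIn Φ.FV = f.domIn Φ.FV :=
      Finset.filter_congr fun x hx => by rw [hr x hx]
    refine ⟨fun x d hx => ?_, ?_⟩
    · by_cases hxF : x ∈ Φ.FV
      · exact h.1 x d (hr x hxF ▸ hx)
      · simp [FinVal.restrict, hxF] at hx
    · rw [hd]
      refine World.mem_congr (fun x hx => ?_) h.2
      simp only [FinVal.toVal, hr x (FinVal.mem_domIn.1 hx).1]
  E_app := by
    rintro t s Φ Ψ f w ⟨h1, h2⟩
    have hX : ∀ x ∈ f.domIn (Φ.FV ∪ Ψ.FV), x ∈ f.Dom := fun x hx => (FinVal.mem_domIn.1 hx).2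
    have hs : ∀ S ⊆ Φ.FV ∪ Ψ.FV, f.domIn S ⊆ f.domIn (Φ.FV ∪ Ψ.FV) := fun S hS =>
      Finset.filter_subset_filter _ hS
    have hf := h1.1
    rw [mem_canonicalE_iff hf hX (hs _ subset_rfl)] at h1
    rw [mem_canonicalE_iff hf hX (hs _ Finset.subset_union_left)] at h2
    rw [mem_canonicalE_iff hf hX (hs _ Finset.subset_union_right)]
    exact World.mem_of_prov₂ (.ofAxiom (.justApp t s _ Φ Ψ)) h1 h2 (livesIn_just hf hX _ _)
  E_sum := by
    rintro t s Φ f w (h | h)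
    · exact ⟨h.1, World.mem_of_prov (.ofAxiom (.sumLeft t s _ Φ)) h.2 (w.lives (just t _ Φ, _) h.2)⟩
    · exact ⟨h.1, World.mem_of_prov (.ofAxiom (.sumRight t s _ Φ)) h.2 (w.lives (just s _ Φ, _) h.2)⟩
  E_bang := by
    intro t Φ f g X w h hfg hg hX hXg
    refine (mem_canonicalE_iff (X := X) hg (fun x hx => hXg hx)
      fun x hx => (FinVal.mem_domIn (S := X).1 hx).1).2 ?_
    have hl := livesIn_just hg (X := X) (fun x hx => hXg hx)
    have hsub : f.domIn Φ.FV ⊆ X := fun x hx =>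
      hX ⟨(FinVal.mem_domIn.1 hx).2, (FinVal.mem_domIn.1 hx).1⟩
    have h1 : (just t (f.domIn Φ.FV) Φ, g.toVal) ∈ w.T :=
      World.mem_congr (fun x hx => hfg.toVal (FinVal.mem_domIn.1 hx).2) h.2
    exact World.mem_of_prov (.ofAxiom (.justBang t X Φ))
      (World.mem_of_prov (.just_mono hsub t Φ) h1 (hl _ _)) (hl _ _)
  E_gen := by
    intro t Φ f x hx w h
    have hx' : x ∉ f.domIn Φ.FV := fun h' =>
      hx ⟨(FinVal.mem_domIn.1 h').2, (FinVal.mem_domIn.1 h').1⟩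
    refine (mem_canonicalE_iff (X := f.domIn Φ.FV) h.1
      (fun x hx => (FinVal.mem_domIn.1 hx).2)
      (Finset.filter_subset_filter _ (Finset.erase_subset _ _))).2 ?_
    exact World.mem_of_prov (.ofAxiom (.justGen t _ x Φ hx')) h.2
      (w.lives (just t _ Φ, _) h.2)

lemma canonicalModel_meets (h0 : Consistent CS ∅) :
    (canonicalModel CS h0).Meets CS := by
  intro c Φ hc
  refine Set.eq_univ_of_forall fun w => ?_
  have hf : (FinVal.empty : FinVal ℕ).ImIn w.D := fun x d hx => by simp [FinVal.empty] at hx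
  have hX : ∀ x ∈ (∅ : Finset Var), x ∈ (FinVal.empty : FinVal ℕ).Dom := by simp
  refine (mem_canonicalE_iff hf hX fun x hx => ?_).2
    (World.mem_of_thm (Derivable.cs _ hc) (livesIn_just hf hX _ _))
  exact absurd rfl (FinVal.mem_domIn.1 hx).2

/-- The clause for `□_X` in the definition of truth, read in the canonical model. -/
lemma World.mem_box_iff (hCS : IsConstantSpecification CS) {X : Finset Var} {ν : Var → ℕ}
    (hl : LivesIn w.D (box X Φ, ν)) :
    (box X Φ, ν) ∈ w.T ↔ ∀ u, World.rel w u → ∀ μ : Var → ℕ,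
      (∀ y, y ∉ Φ.FV \ X → μ y = ν y) → (∀ y ∈ Φ.FV \ X, μ y ∈ u.D) → (Φ, μ) ∈ u.T := by
  constructor
  · intro h u hR μ hμ hμD
    have hμX : ∀ x ∈ X, μ x = ν x := fun x hx => hμ x fun h => (Finset.mem_sdiff.1 h).2 hx
    refine hR.2 X Φ ν μ h hμX fun x hx => ?_
    by_cases hxX : x ∈ X
    · change μ x ∈ u.D
      rw [hμX x hxX]
      exact hR.1 (hl x hxX)
    · exact hμD x (Finset.mem_sdiff.2 ⟨hx, hxX⟩)
  · intro h
    by_contra hn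
    obtain ⟨u, hR, μ, hμ, hμD, hu⟩ := World.exists_rel_of_not_mem_box hCS hl hn
    exact hu (h u hR μ hμ hμD)

/-- The truth lemma. -/
theorem sat_canonicalModel_iff (hCS : IsConstantSpecification CS) (h0 : Consistent CS ∅)
    (Φ : Formula) (ν : Var → ℕ) (w : World CS) (hl : LivesIn w.D (Φ, ν)) :
    (canonicalModel CS h0).Sat Φ ν w ↔ (Φ, ν) ∈ w.T := by
  -- Truth of `Φ` at all relevant successors, given the claim for `Φ`.
  have hbox : ∀ {Φ : Formula} {ν : Var → ℕ} {w : World CS} {X : Finset Var},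
      (∀ (ν : Var → ℕ) (w : World CS), LivesIn w.D (Φ, ν) →
        ((canonicalModel CS h0).Sat Φ ν w ↔ (Φ, ν) ∈ w.T)) → LivesIn w.D (box X Φ, ν) →
      ((∀ u : World CS, World.rel w u → ∀ μ : Var → ℕ, (∀ y, y ∉ Φ.FV \ X → μ y = ν y) →
        (∀ y ∈ Φ.FV \ X, μ y ∈ u.D) → (canonicalModel CS h0).Sat Φ μ u) ↔
        (box X Φ, ν) ∈ w.T) := by
    intro Φ ν w X ih hl
    rw [World.mem_box_iff hCS hl]
    refine forall₅_congr fun u hR μ hμ hμD => ih μ u fun x hx => ?_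
    by_cases hxX : x ∈ X
    · have : μ x = ν x := hμ x fun h => (Finset.mem_sdiff.1 h).2 hxX
      change μ x ∈ u.D
      rw [this]
      exact hR.1 (hl x hxX)
    · exact hμD x (Finset.mem_sdiff.2 ⟨hx, hxX⟩)
  induction Φ generalizing ν w with
  | atom n i xs =>
    constructor
    · rintro ⟨ys, μ, h, e⟩
      refine World.mem_of_tr_eq h (fun ρ => ?_) hl
      simp only [tr, subst]
      congr 1
      funext k
      exact congrArg ρ (congrFun e k).symm
    · exact fun h => ⟨xs, ν, h, rfl⟩
  | neg Φ ih =>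
    exact (and_iff_right hl).trans ((not_congr (ih ν w hl)).trans (World.mem_neg_iff (Φ := Φ) hl).symm)
  | conj Φ Ψ h1 h2 =>
    exact (and_congr (h1 ν w (World.livesIn_left rfl hl))
      (h2 ν w (World.livesIn_right rfl hl))).trans (World.mem_conj_iff hl).symm
  | disj Φ Ψ h1 h2 =>
    exact (and_iff_right hl).trans ((or_congr (h1 ν w (World.livesIn_left rfl hl))
      (h2 ν w (World.livesIn_right rfl hl))).trans (World.mem_disj_iff hl).symm)
  | imp Φ Ψ h1 h2 =>
    have hΦ : LivesIn w.D (Φ, ν) := World.livesIn_left rfl hl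
    have hΨ : LivesIn w.D (Ψ, ν) := World.livesIn_right rfl hl
    exact (and_iff_right hl).trans ((imp_congr (h1 ν w hΦ) (h2 ν w hΨ)).trans
      (World.mem_imp_iff hΦ hΨ).symm)
  | iff Φ Ψ h1 h2 =>
    exact (and_iff_right hl).trans ((iff_congr (h1 ν w (World.livesIn_left rfl hl))
      (h2 ν w (World.livesIn_right rfl hl))).trans (World.mem_biimp_iff hl).symm)
  | all x Φ ih =>
    rw [World.mem_all_iff hl]
    exact forall₂_congr fun a ha => ih _ w (World.livesIn_update hl ha)
  | ex x Φ ih =>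
    rw [World.mem_ex_iff hl]
    exact (and_iff_right hl).trans <| exists_congr fun a => and_congr_right fun ha =>
      ih _ w (World.livesIn_update hl ha)
  | box X Φ ih => exact (and_iff_right hl).trans (hbox ih hl)
  | just t X Φ ih =>
    refine (and_iff_right hl).trans ((and_congr_left' (hbox ih hl)).trans ?_)
    set f : FinVal ℕ := FinVal.ofVal ν (Φ.FV ∩ X) with hf
    have hfx : ∀ x ∈ Φ.FV ∩ X, f.toFun x = some (ν x) := fun x hx => if_pos hx
    have hfd : ∀ x, x ∈ f.Dom ↔ x ∈ Φ.FV ∩ X := fun x => by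
      change (if x ∈ Φ.FV ∩ X then some (ν x) else none) ≠ none ↔ _
      by_cases hx : x ∈ Φ.FV ∩ X
      · rw [if_pos hx]; simpa using hx
      · rw [if_neg hx]; simpa using hx
    have hfi : f.ImIn w.D := by
      intro x d hx
      have hxX : x ∈ Φ.FV ∩ X := (hfd x).1 (show f.toFun x ≠ none by simp [hx])
      rw [hfx x hxX, Option.some.injEq] at hx
      exact hx ▸ hl x (Finset.mem_inter.1 hxX).2
    have hE : w ∈ canonicalE CS t Φ f ↔ (just t X Φ, ν) ∈ w.T := by
      rw [mem_canonicalE_iff (X := Φ.FV ∩ X) hfi (fun x hx => (hfd x).2 hx)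
        (fun x hx => (hfd x).1 (FinVal.mem_domIn.1 hx).2),
        ← World.mem_just_iff (X := Φ.FV ∩ X) (Y := X) Finset.inter_subset_right
          (fun y hy hn hyF => hn (Finset.mem_inter.2 ⟨hyF, hy⟩)) hl]
      have hv : ∀ x ∈ Φ.FV ∩ X, f.toVal x = ν x := fun x hx => by
        simp [FinVal.toVal, hfx x hx]
      exact ⟨World.mem_congr hv, World.mem_congr fun x hx => (hv x hx).symm⟩
    exact (and_congr_right' hE).trans
      ⟨And.right, fun h => ⟨World.mem_of_prov (.ofAxiom (.justBox t X Φ)) h hl, h⟩⟩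

end FOLPBox

theorem mainTheorem2 (CS : Set FOLPBox.Formula) (hCS : FOLPBox.IsConstantSpecification CS)
    (Γ : Set FOLPBox.Formula) (hΓ : ∀ Ψ ∈ Γ, Ψ.Closed)
    (Φ : FOLPBox.Formula) (hΦ : Φ.Closed)
    (hnd : ¬ FOLPBox.Derivable CS Γ Φ) :
    ∃ M : FOLPBox.FittingModel, M.Meets CS ∧
      ∃ (ν : FOLPBox.Var → M.U) (w : M.W),
        (∀ Ψ ∈ Γ, M.Sat Ψ ν w) ∧ ¬ M.Sat Φ ν w := by
  have hc := FOLPBox.consistent_of_not_derivable hΓ hΦ hnd (fun _ => 0)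
  have h0 := hc.mono (Set.empty_subset _)
  have hlive : ∀ (D : Set ℕ) {Ψ : FOLPBox.Formula}, Ψ.Closed →
      FOLPBox.LivesIn D (Ψ, fun _ => 0) := by
    intro D Ψ hΨ x hx
    simp [show Ψ.FV = ∅ from hΨ] at hx
  obtain ⟨w, -, hw⟩ := hc.exists_world (D := ∅)
    (by
      rintro d (rfl | ⟨Ψ, hΨ, rfl⟩)
      exacts [hlive ∅ (Ψ := .neg Φ) hΦ, hlive ∅ (hΓ Ψ hΨ)])
    (by simpa using Set.infinite_univ)
  refine ⟨FOLPBox.canonicalModel CS h0, FOLPBox.canonicalModel_meets h0, fun _ => (0 : ℕ), w,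
    fun Ψ hΨ => ?_, fun h => ?_⟩
  · exact (FOLPBox.sat_canonicalModel_iff hCS h0 Ψ _ w (hlive _ (hΓ Ψ hΨ))).2
      (hw (.inr ⟨Ψ, hΨ, rfl⟩))
  · exact (FOLPBox.World.mem_neg_iff (hlive _ hΦ)).1 (hw (Set.mem_insert _ _))
      ((FOLPBox.sat_canonicalModel_iff hCS h0 Φ _ w (hlive _ hΦ)).1 h)
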